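/- \textbf{Setting.} Let $f:\mathbb{R}^n\to\mathbb{R}$, with gradient $g=\nabla f$ and Hessian $G=\nabla^2 f$; $\|\cdot\|$ is the Euclidean norm, or the induced operator norm. Fix a block size $q\ge 1$, line search parameters $0<\alpha<\tfrac12$, $\alpha<\beta<1$, a threshold $\tau>0$, a starting point $x_1^{(1)}\in\mathbb{R}^n$ and a symmetric positive definite matrix $B_1$. \textbf{Block BFGS.} For $k=1,2,\dots$: for $i=1,\dots,q$ put $d_k^{(i)}=-B_k^{-1}g(x_k^{(i)})$, $s_k^{(i)}=\lambda_k^{(i)}d_k^{(i)}$ and $x_k^{(i+1)}=x_k^{(i)}+s_k^{(i)}$, where $\lambda=\lambda_k^{(i)}$ is any step size satisfying, with $x=x_k^{(i)}$ and $d=d_k^{(i)}$, the Armijo--Wolfe conditions $$f(x+\lambda d)\le f(x)+\alpha\lambda\langle g(x),d\rangle,\qquad \langle g(x+\lambda d),d\rangle\ge\beta\langle g(x),d\rangle,$$ and $\lambda=1$ is chosen whenever it satisfies them. Put $G_k=G(x_k^{(q+1)})$. The matrix $D_k$ consists of the columns of $S_k=[s_k^{(1)}\cdots s_k^{(q)}]$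 that survive the following filtering: the columns are examined from left to right while an $L\Sigma L^T$ decomposition is computed ($L$ unit lower triangular, $\Sigma$ diagonal); the column $s_i$ is retained if and only if $$\sigma_i^2:=[S_k^TG_kS_k]_{ii}-\sum_{j<i,\ j\text{ retained}}L_{ij}^2\Sigma_{jj}\ \ge\ \tau\|s_i\|^2,$$ in which case $\Sigma_{ii}=\sigma_i^2$ and $L_{ji}=\Sigma_{ii}^{-1}\bigl([S_k^TG_kS_k]_{ji}-\sum_{p<i,\ p\text{ retained}}L_{ip}L_{jp}\Sigma_{pp}\bigr)$ for $j>i$; otherwise it is deleted. If $D_k$ is empty, $B_{k+1}=B_k$; otherwise $$B_{k+1}=B_k-B_kD_k(D_k^TB_kD_k)^{-1}D_k^TB_k+G_kD_k(D_k^TG_kD_k)^{-1}D_k^TG_k.$$ Finally $x_{k+1}^{(1)}=x_k^{(q+1)}$. \textbf{Theorem.} Assume that (1) $f$ is convex and twice differentiable, and for some $M$, $G(x)\preceq MI$ on the level set $\{x: f(x)\le f(x_1^{(1)})\}$; (2) $f$ has a minimizer $x_*$ with $G(x_*)$ nonsingular; (3) $G$ is Lipschitz continuous in a neighborhood of $x_*$;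 and that $\tau\le m$, where $m>0$ is a constant with $G(x)\succeq mI$ for all $x$ in a neighborhood of $x_*$. Then for every run of Block BFGS the iterates converge to $x_*$ (and stay at $x_*$ should they ever reach it), $D_k$ is nonempty for all sufficiently large $k$, and the convergence is $Q$-superlinear along the steps in $D_k$: $$\lim_{\substack{k\to\infty\\ s_k^{(i)}\in D_k}}\frac{\|x_k^{(i+1)}-x_*\|}{\|x_k^{(i)}-x_*\|}=0,$$ where a quotient with $x_k^{(i)}=x_*$ (and hence $x_k^{(i+1)}=x_*$) is read as $0$. -/

import Mathlib

open Filter Topology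
open scoped Matrix Matrix.Norms.L2Operator

noncomputable section

namespace BlockBFGS

/-- The space `ℝⁿ` with its Euclidean norm and standard inner product. -/
abbrev Vec (n : ℕ) : Type := EuclideanSpace ℝ (Fin n)

/-- The Hessian matrix `G(x) = ∇² f(x)`: the matrix of the derivative of the gradient. -/
def hessian {n : ℕ} (f : Vec n → ℝ) (x : Vec n) : Matrix (Fin n) (Fin n) ℝ :=
  (Matrix.toEuclideanCLM (n := Fin n) (𝕜 := ℝ)).symm (fderiv ℝ (gradient f) x)

/-- The quasi-Newton direction `d = -B⁻¹ g(x)`. -/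
def direction {n : ℕ} (f : Vec n → ℝ) (B : Matrix (Fin n) (Fin n) ℝ) (x : Vec n) : Vec n :=
  -(Matrix.toEuclideanCLM (n := Fin n) (𝕜 := ℝ) B⁻¹ (gradient f x))

/-- The Armijo and Wolfe conditions with parameters `α`, `β` for the step size `lam` at the
point `x` in the direction `d`. -/
def ArmijoWolfe {n : ℕ} (f : Vec n → ℝ) (α β : ℝ) (x d : Vec n) (lam : ℝ) : Prop :=
  f (x + lam • d) ≤ f x + α * lam * inner ℝ (gradient f x) d ∧
    β * inner ℝ (gradient f x) d ≤ inner ℝ (gradient f (x + lam • d)) d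

/-- A step size that the line search may return: it satisfies the Armijo-Wolfe conditions, and
it is `1` whenever `1` satisfies them. -/
def IsLineSearchStep {n : ℕ} (f : Vec n → ℝ) (α β : ℝ) (x d : Vec n) (lam : ℝ) : Prop :=
  ArmijoWolfe f α β x d lam ∧ (ArmijoWolfe f α β x d 1 → lam = 1)

/-- The matrix `[s₁ ⋯ s_q]` with the given columns. -/
def colMatrix {n : ℕ} {ι : Type} (s : ι → Vec n) : Matrix (Fin n) ι ℝ :=
  Matrix.of fun r i => s i r

/-- The variables of the filtering procedure. Columns keep their original indices: `kept` holds
the indices of the columns examined so far and not deleted, and only the rows and columns of `L`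
and entries of `Sig` (the diagonal of `Σ`) at indices that have not been deleted are ever read. -/
structure FilterState (q : ℕ) where
  kept : Finset (Fin q)
  L : Matrix (Fin q) (Fin q) ℝ
  Sig : Fin q → ℝ

/-- The number `σᵢ² = Aᵢᵢ - ∑ⱼ Lᵢⱼ² Σⱼⱼ`, the sum being over the retained columns before `i`. -/
def FilterState.pivot {q : ℕ} (A : Matrix (Fin q) (Fin q) ℝ) (st : FilterState q) (i : Fin q) :
    ℝ :=
  A i i - ∑ j ∈ st.kept, st.L i j ^ 2 * st.Sig j

/-- One pass of the filtering loop, examining the column `s i`; here `A = Sᵀ G S`. If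
`σᵢ² ≥ τ ‖sᵢ‖²`, the column is retained, `Σᵢᵢ` is set to `σᵢ²` and the column `i` of `L` is
computed; otherwise the column is deleted. -/
def filterPass {n q : ℕ} (τ : ℝ) (s : Fin q → Vec n) (A : Matrix (Fin q) (Fin q) ℝ)
    (st : FilterState q) (i : Fin q) : FilterState q :=
  if τ * ‖s i‖ ^ 2 ≤ st.pivot A i then
    { kept := insert i st.kept
      Sig := Function.update st.Sig i (st.pivot A i)
      L := Matrix.of fun j l =>
        if l = i then
          if j = i then 1
          else if i < j then
            (1 / st.pivot A i) * (A j i - ∑ p ∈ st.kept, st.L i p * st.L j p * st.Sig p)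
          else st.L j l
        else st.L j l }
  else st

/-- The procedure `filtersteps` with threshold `τ`, applied to the steps `s₁, …, s_q` and the
matrix `G`: the set of indices of the steps that are retained as columns of `D`. -/
def filterSteps {n q : ℕ} (τ : ℝ) (s : Fin q → Vec n) (G : Matrix (Fin n) (Fin n) ℝ) :
    Finset (Fin q) :=
  ((List.finRange q).foldl (filterPass τ s ((colMatrix s)ᵀ * G * colMatrix s))
    { kept := ∅, L := 0, Sig := 0 }).kept

/-- The block update
`B - B D (Dᵀ B D)⁻¹ Dᵀ B + G D (Dᵀ G D)⁻¹ Dᵀ G`. -/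
def blockUpdate {n : ℕ} {ι : Type} [Fintype ι] [DecidableEq ι]
    (B G : Matrix (Fin n) (Fin n) ℝ) (D : Matrix (Fin n) ι ℝ) : Matrix (Fin n) (Fin n) ℝ :=
  B - B * D * (Dᵀ * B * D)⁻¹ * Dᵀ * B + G * D * (Dᵀ * G * D)⁻¹ * Dᵀ * G

/-- The steps `sᵢ = λᵢ dᵢ`, `dᵢ = -B⁻¹ g(xᵢ)`, of one block with iterates `x₁, …, x_{q+1}` and
step sizes `λ₁, …, λ_q`. -/
def blockSteps {n q : ℕ} (f : Vec n → ℝ) (B : Matrix (Fin n) (Fin n) ℝ)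
    (x : Fin (q + 1) → Vec n) (lam : Fin q → ℝ) (i : Fin q) : Vec n :=
  lam i • direction f B (x i.castSucc)

/-- The set of indices `i` such that the `i`-th step of the block is a column of `D`, the
filtering being done with the Hessian at the last iterate of the block. -/
def keptSteps {n q : ℕ} (f : Vec n → ℝ) (τ : ℝ) (B : Matrix (Fin n) (Fin n) ℝ)
    (x : Fin (q + 1) → Vec n) (lam : Fin q → ℝ) : Finset (Fin q) :=
  filterSteps τ (blockSteps f B x lam) (hessian f (x (Fin.last q)))

/-- `x`, `B`, `lam` are the iterates, matrices and step sizes of a run of Block BFGS on `f` with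
block size `q`, Armijo-Wolfe parameters `α`, `β`, filtering threshold `τ`, starting point `x₁` and
starting matrix `B₁`. Blocks and steps are numbered from `0`: `x k i` is the iterate
`x_{k+1}^{(i+1)}`, and so on. -/
structure IsRun {n q : ℕ} (f : Vec n → ℝ) (α β τ : ℝ) (x₁ : Vec n)
    (B₁ : Matrix (Fin n) (Fin n) ℝ) (x : ℕ → Fin (q + 1) → Vec n)
    (B : ℕ → Matrix (Fin n) (Fin n) ℝ) (lam : ℕ → Fin q → ℝ) : Prop where
  start_point : x 0 0 = x₁
  start_matrix : B 0 = B₁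
  line_search : ∀ (k : ℕ) (i : Fin q),
    IsLineSearchStep f α β (x k i.castSucc) (direction f (B k) (x k i.castSucc)) (lam k i)
  step : ∀ (k : ℕ) (i : Fin q),
    x k i.succ = x k i.castSucc + blockSteps f (B k) (x k) (lam k) i
  update : ∀ k : ℕ, (keptSteps f τ (B k) (x k) (lam k)).Nonempty →
    B (k + 1) = blockUpdate (B k) (hessian f (x k (Fin.last q)))
      (colMatrix fun i : keptSteps f τ (B k) (x k) (lam k) =>
        blockSteps f (B k) (x k) (lam k) i)
  no_update : ∀ k : ℕ, keptSteps f τ (B k) (x k) (lam k) = ∅ → B (k + 1) = B k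
  next_block : ∀ k : ℕ, x (k + 1) 0 = x k (Fin.last q)

end BlockBFGS

end

/-!
The proof follows the trace-determinant method of Powell, Byrd and Nocedal, carried out for block
updates. For a positive definite `H`, the potential `ψ_H(B) = tr (H⁻¹ B) - log det B` is bounded
below. A block update only depends on the column space of `D`; in a basis `d₁, …, d_r` of it which
is orthonormal for `H` and orthogonal for `B`, the change of the potential decouples
(`exists_basis_potential_blockUpdate_le`): up to a term that measures the distance from `G` to `H`,
the potential drops by `∑ (uⱼ - 1 - log lⱼ)`, where `lⱼ = dⱼ · B dⱼ` and
`uⱼ = (B dⱼ · H⁻¹ B dⱼ) / lⱼ`. As `uⱼ ≥ lⱼ`, every summand is nonnegative, and it is large when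
`dⱼ` and `B dⱼ` are nearly orthogonal. The filtering makes `G` uniformly positive definite on the
column space of `D`, so that these estimates are uniform (`filterSteps_spec`).

*Convergence* (`H = I`). A step with angle `θ` between `s` and `B s` reduces `f - f xs` by a factor
`1 - κ cos² θ` (`LevelSetBounds.step`), while a block update increases the potential by at most a
constant plus `log |cos θ|`, for the angle `θ` of any retained step (`exp_potential_sub_le`). If `f`
did not converge to its minimum, all angles would tend to a right angle, hence the potential would
be bounded, hence the angles would be bounded away from a right angle. So the iterates converge.
Near the minimizer the first column of every block is retained, and then
`(f - f xs) exp (2 ν ψ)` decays geometrically for a small constant `ν`; thus the errors are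
summable (`summable_norm_sub`).

*Superlinear convergence* (`H` the Hessian at `xs`). By the Lipschitz condition and the summability
of the errors, the increases of the potential are summable, so its decreases tend to `0` as well;
this forces `‖(B - H) s‖ = o(‖s‖)` along the retained steps (`eventually_norm_sub_hessian_le`).
Then `-B⁻¹ g` is nearly the Newton step, the step size `1` is accepted, and the step is superlinear
(`exists_unit_step`).

A run that reaches `xs` stays there, and is treated separately: from then on the steps vanish and
`D` has zero columns, so that `Dᵀ B D` and `Dᵀ G D` are singular.
-/

namespace BlockBFGS

/-! ### Linear algebra of the block update -/

section LinearAlgebra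

variable {n ι : Type*} [Fintype n] [Fintype ι]

theorem posDef_transpose_mul_mul {A : Matrix n n ℝ} (hA : A.PosDef) {D : Matrix n ι ℝ}
    (hD : Function.Injective D.mulVec) : (Dᵀ * A * D).PosDef := by
  simpa using hA.conjTranspose_mul_mul_same hD

theorem posSemidef_transpose_mul_mul {A : Matrix n n ℝ} (hA : A.PosSemidef) (D : Matrix n ι ℝ) :
    (Dᵀ * A * D).PosSemidef := by
  simpa using hA.conjTranspose_mul_mul_same D

theorem mulVec_injective_of_isUnit_det [DecidableEq ι] {R : Matrix ι ι ℝ} (hR : IsUnit R.det) :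
    Function.Injective R.mulVec :=
  Matrix.mulVec_injective_of_isUnit ((Matrix.isUnit_iff_isUnit_det R).2 hR)

theorem transpose_eq_of_posDef {n : Type*} {A : Matrix n n ℝ} (hA : A.PosDef) : Aᵀ = A := by
  simpa using hA.isHermitian.eq

theorem exists_orthogonal_diagonalization [DecidableEq ι] {A : Matrix ι ι ℝ} (hA : A.PosDef) :
    ∃ (R : Matrix ι ι ℝ) (l : ι → ℝ), Rᵀ * R = 1 ∧ Rᵀ * A * R = Matrix.diagonal l ∧
      ∀ i, 0 < l i := by
  refine ⟨hA.1.eigenvectorUnitary, hA.1.eigenvalues, ?_, ?_, hA.eigenvalues_pos⟩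
  · have := Unitary.coe_star_mul_self hA.1.eigenvectorUnitary
    simpa [Matrix.star_eq_conjTranspose] using this
  · have := hA.1.conjStarAlgAut_star_eigenvectorUnitary
    rw [Unitary.conjStarAlgAut_star_apply] at this
    simpa [Matrix.star_eq_conjTranspose, Function.comp_def] using this

/-- A positive definite form has an orthonormal basis. -/
theorem exists_normalization [DecidableEq ι] {A : Matrix ι ι ℝ} (hA : A.PosDef) :
    ∃ R : Matrix ι ι ℝ, IsUnit R.det ∧ Rᵀ * A * R = 1 := by
  obtain ⟨U, l, hU, hUA, hl⟩ := exists_orthogonal_diagonalization hA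
  have key : (U * Matrix.diagonal fun i => (Real.sqrt (l i))⁻¹)ᵀ * A *
      (U * Matrix.diagonal fun i => (Real.sqrt (l i))⁻¹) = 1 := by
    rw [Matrix.transpose_mul, Matrix.diagonal_transpose]
    calc _ = (Matrix.diagonal fun i => (Real.sqrt (l i))⁻¹) * (Uᵀ * A * U) *
          (Matrix.diagonal fun i => (Real.sqrt (l i))⁻¹) := by simp only [Matrix.mul_assoc]
      _ = 1 := by
        rw [hUA, Matrix.diagonal_mul_diagonal, Matrix.diagonal_mul_diagonal, ← Matrix.diagonal_one]
        congr 1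
        funext i
        have h := Real.sqrt_pos.2 (hl i)
        have h2 := Real.mul_self_sqrt (hl i).le
        field_simp
        nlinarith
  refine ⟨_, ?_, key⟩
  have h := congrArg Matrix.det key
  rw [Matrix.det_mul, Matrix.det_one] at h
  exact IsUnit.of_mul_eq_one_right _ h

/-- Two positive definite forms are diagonal in a common basis. -/
theorem exists_simultaneous_diagonalization [DecidableEq ι] {A C : Matrix ι ι ℝ}
    (hA : A.PosDef) (hC : C.PosDef) :
    ∃ (R : Matrix ι ι ℝ) (l : ι → ℝ), IsUnit R.det ∧ Rᵀ * A * R = 1 ∧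
      Rᵀ * C * R = Matrix.diagonal l ∧ ∀ i, 0 < l i := by
  obtain ⟨R, hR, hRA⟩ := exists_normalization hA
  obtain ⟨U, l, hU, hUC, hl⟩ := exists_orthogonal_diagonalization
    (posDef_transpose_mul_mul hC (mulVec_injective_of_isUnit_det hR))
  have hdet := congrArg Matrix.det hU
  rw [Matrix.det_mul, Matrix.det_one] at hdet
  refine ⟨R * U, l, ?_, ?_, ?_, hl⟩
  · rw [Matrix.det_mul]
    exact hR.mul (IsUnit.of_mul_eq_one_right _ hdet)
  · calc _ = Uᵀ * (Rᵀ * A * R) * U := by simp only [Matrix.transpose_mul, Matrix.mul_assoc]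
      _ = 1 := by rw [hRA, Matrix.mul_one, hU]
  · rw [← hUC]
    simp only [Matrix.transpose_mul, Matrix.mul_assoc]

theorem mul_inv_mul_mul_right [DecidableEq ι] (X : Matrix n n ℝ) (D : Matrix n ι ℝ)
    {R : Matrix ι ι ℝ} (hR : IsUnit R.det) :
    X * (D * R) * ((D * R)ᵀ * X * (D * R))⁻¹ * (D * R)ᵀ * X =
      X * D * (Dᵀ * X * D)⁻¹ * Dᵀ * X := by
  have hR' : IsUnit Rᵀ.det := by rwa [Matrix.det_transpose]
  have h1 : (D * R)ᵀ * X * (D * R) = Rᵀ * (Dᵀ * X * D) * R := by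
    simp only [Matrix.transpose_mul, Matrix.mul_assoc]
  rw [h1, Matrix.mul_inv_rev, Matrix.mul_inv_rev, Matrix.transpose_mul]
  calc _ = X * D * (R * R⁻¹) * (Dᵀ * X * D)⁻¹ * (Rᵀ⁻¹ * Rᵀ) * Dᵀ * X := by
        simp only [Matrix.mul_assoc]
    _ = _ := by rw [Matrix.mul_nonsing_inv _ hR, Matrix.nonsing_inv_mul _ hR', Matrix.mul_one,
      Matrix.mul_one]

/-- The block update only depends on the column space of `D`. -/
theorem blockUpdate_mul_right {n : ℕ} {ι : Type} [Fintype ι] [DecidableEq ι]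
    (B G : Matrix (Fin n) (Fin n) ℝ) (D : Matrix (Fin n) ι ℝ)
    {R : Matrix ι ι ℝ} (hR : IsUnit R.det) : blockUpdate B G (D * R) = blockUpdate B G D := by
  rw [blockUpdate, blockUpdate, mul_inv_mul_mul_right B D hR, mul_inv_mul_mul_right G D hR]

theorem det_fromBlocks_zero_one [DecidableEq ι] (N Y : Matrix ι ι ℝ) :
    (Matrix.fromBlocks (0 : Matrix ι ι ℝ) 1 (-N) Y).det = N.det := by
  have h : Matrix.fromBlocks (0 : Matrix ι ι ℝ) 1 (-N) Y *
      (Matrix.fromBlocks (1 : Matrix ι ι ℝ) (-1) 0 1 *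
        Matrix.fromBlocks (1 : Matrix ι ι ℝ) 0 1 1 *
        Matrix.fromBlocks (1 : Matrix ι ι ℝ) (-1) 0 1) = Matrix.fromBlocks 1 0 Y N := by
    simp [Matrix.fromBlocks_multiply]
  have h2 := congrArg Matrix.det h
  simpa [Matrix.det_mul, Matrix.det_fromBlocks_zero₁₂, Matrix.det_fromBlocks_zero₂₁] using h2

/-- The determinant formula for the block update, from the matrix determinant lemma for the rank
`2r` perturbation `B ↦ blockUpdate B G D`. -/
theorem det_blockUpdate {n : ℕ} {ι : Type} [Fintype ι] [DecidableEq ι]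
    {B G : Matrix (Fin n) (Fin n) ℝ} {D : Matrix (Fin n) ι ℝ} (hB : IsUnit B.det)
    (hA : IsUnit (Dᵀ * B * D).det) (hΓ : IsUnit (Dᵀ * G * D).det) :
    (blockUpdate B G D).det * (Dᵀ * B * D).det = B.det * (Dᵀ * G * D).det := by
  set A := Dᵀ * B * D with hAdef
  set Γ := Dᵀ * G * D with hΓdef
  have h1 : blockUpdate B G D = B + Matrix.fromCols (-(B * D * A⁻¹)) (G * D * Γ⁻¹) *
      Matrix.fromRows (Dᵀ * B) (Dᵀ * G) := by
    rw [Matrix.fromCols_mul_fromRows, blockUpdate]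
    simp only [Matrix.neg_mul, ← Matrix.mul_assoc, hAdef, hΓdef]
    abel
  have e1 : Dᵀ * B * B⁻¹ = Dᵀ := by
    rw [Matrix.mul_assoc, Matrix.mul_nonsing_inv _ hB, Matrix.mul_one]
  have h2 : 1 + Matrix.fromRows (Dᵀ * B) (Dᵀ * G) * B⁻¹ *
      Matrix.fromCols (-(B * D * A⁻¹)) (G * D * Γ⁻¹) =
      Matrix.fromBlocks 0 1 (-(Γ * A⁻¹)) (1 + Dᵀ * G * B⁻¹ * (G * D * Γ⁻¹)) := by
    rw [Matrix.fromRows_mul, Matrix.fromRows_mul_fromCols, ← Matrix.fromBlocks_one,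
      Matrix.fromBlocks_add]
    congr 1
    · rw [e1, Matrix.mul_neg, ← Matrix.mul_assoc, ← Matrix.mul_assoc, ← hAdef,
        Matrix.mul_nonsing_inv _ hA, add_neg_cancel]
    · rw [e1, ← Matrix.mul_assoc, ← Matrix.mul_assoc, ← hΓdef, Matrix.mul_nonsing_inv _ hΓ,
        zero_add]
    · have : Dᵀ * G * B⁻¹ * (B * D * A⁻¹) = Dᵀ * G * (B⁻¹ * B) * D * A⁻¹ := by
        simp only [Matrix.mul_assoc]
      rw [zero_add, Matrix.mul_neg, this, Matrix.nonsing_inv_mul _ hB, Matrix.mul_one, ← hΓdef]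
  rw [h1, Matrix.det_add_mul _ _ hB, h2, det_fromBlocks_zero_one, Matrix.det_mul, mul_assoc,
    mul_assoc, ← Matrix.det_mul, Matrix.nonsing_inv_mul _ hA, Matrix.det_one, mul_one]

/-- The block update is `(1 - P)ᵀ B (1 - P) + G D (Dᵀ G D)⁻¹ Dᵀ G`, where `P` is the `B`-orthogonal
projection onto the column space of `D`. -/
theorem posSemidef_blockUpdate {n : ℕ} {ι : Type} [Fintype ι] [DecidableEq ι]
    {B G : Matrix (Fin n) (Fin n) ℝ} {D : Matrix (Fin n) ι ℝ} (hB : B.PosDef)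
    (hA : (Dᵀ * B * D).PosDef) (hG : Gᵀ = G) (hΓ : (Dᵀ * G * D).PosDef) :
    (blockUpdate B G D).PosSemidef := by
  have hBs := transpose_eq_of_posDef hB
  have hAs := transpose_eq_of_posDef hA
  have hAu : IsUnit (Dᵀ * B * D).det := isUnit_iff_ne_zero.2 hA.det_pos.ne'
  have h1 : B - B * D * (Dᵀ * B * D)⁻¹ * Dᵀ * B =
      (1 - D * (Dᵀ * B * D)⁻¹ * Dᵀ * B)ᵀ * B * (1 - D * (Dᵀ * B * D)⁻¹ * Dᵀ * B) := by
    set A := Dᵀ * B * D with hAdef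
    have e : (1 - D * A⁻¹ * Dᵀ * B)ᵀ = 1 - B * D * A⁻¹ * Dᵀ := by
      rw [Matrix.transpose_sub, Matrix.transpose_one, Matrix.transpose_mul, Matrix.transpose_mul,
        Matrix.transpose_mul, Matrix.transpose_nonsing_inv, hAs, hBs, Matrix.transpose_transpose]
      simp only [Matrix.mul_assoc]
    have e2 : B * D * A⁻¹ * Dᵀ * B * (D * A⁻¹ * Dᵀ * B) = B * D * A⁻¹ * Dᵀ * B := by
      calc _ = B * D * A⁻¹ * (Dᵀ * B * D) * A⁻¹ * Dᵀ * B := by simp only [Matrix.mul_assoc]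
        _ = B * D * (A⁻¹ * A) * A⁻¹ * Dᵀ * B := by rw [← hAdef]; simp only [Matrix.mul_assoc]
        _ = _ := by rw [Matrix.nonsing_inv_mul _ hAu, Matrix.mul_one]
    rw [e, Matrix.sub_mul, Matrix.one_mul, Matrix.mul_sub, Matrix.mul_one, Matrix.sub_mul, e2]
    simp only [Matrix.mul_assoc]
    abel
  have h2 : G * D * (Dᵀ * G * D)⁻¹ * Dᵀ * G =
      (Dᵀ * G)ᵀ * (Dᵀ * G * D)⁻¹ * (Dᵀ * G) := by
    rw [Matrix.transpose_mul, hG, Matrix.transpose_transpose]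
    simp only [Matrix.mul_assoc]
  rw [blockUpdate, h1, h2]
  exact (posSemidef_transpose_mul_mul hB.posSemidef _).add
    (posSemidef_transpose_mul_mul hΓ.inv.posSemidef _)

theorem posDef_blockUpdate {n : ℕ} {ι : Type} [Fintype ι] [DecidableEq ι]
    {B G : Matrix (Fin n) (Fin n) ℝ} {D : Matrix (Fin n) ι ℝ} (hB : B.PosDef)
    (hA : (Dᵀ * B * D).PosDef) (hG : Gᵀ = G) (hΓ : (Dᵀ * G * D).PosDef) :
    (blockUpdate B G D).PosDef := by
  rw [(posSemidef_blockUpdate hB hA hG hΓ).posDef_iff_det_ne_zero]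
  have h := det_blockUpdate (isUnit_iff_ne_zero.2 hB.det_pos.ne')
    (isUnit_iff_ne_zero.2 hA.det_pos.ne') (isUnit_iff_ne_zero.2 hΓ.det_pos.ne')
  have h2 : 0 < B.det * (Dᵀ * G * D).det := mul_pos hB.det_pos hΓ.det_pos
  intro h0
  rw [h0, zero_mul] at h
  linarith

/-- For a positive definite matrix, `log det ≤ trace - n`. -/
theorem log_det_le [DecidableEq n] {X : Matrix n n ℝ} (hX : X.PosDef) :
    Real.log X.det ≤ X.trace - Fintype.card n := by
  rw [hX.1.det_eq_prod_eigenvalues, hX.1.trace_eq_sum_eigenvalues]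
  simp only [RCLike.ofReal_real_eq_id, id]
  rw [Real.log_prod fun i _ => (hX.eigenvalues_pos i).ne']
  calc ∑ i, Real.log (hX.1.eigenvalues i) ≤ ∑ i, (hX.1.eigenvalues i - 1) :=
        Finset.sum_le_sum fun i _ => Real.log_le_sub_one_of_pos (hX.eigenvalues_pos i)
    _ = _ := by simp

/-- If `X ⪰ γ I`, then `γ ^ r ≤ det X`. -/
theorem pow_card_le_det [DecidableEq ι] {X : Matrix ι ι ℝ} (hX : X.PosDef) {γ : ℝ} (hγ : 0 ≤ γ)
    (h : ∀ y : ι → ℝ, γ * (y ⬝ᵥ y) ≤ y ⬝ᵥ X *ᵥ y) : γ ^ Fintype.card ι ≤ X.det := by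
  rw [hX.1.det_eq_prod_eigenvalues]
  simp only [RCLike.ofReal_real_eq_id, id]
  rw [← Finset.card_univ, ← Finset.prod_const]
  refine Finset.prod_le_prod (fun _ _ => hγ) fun i _ => ?_
  have h1 := h (hX.1.eigenvectorBasis i)
  rw [hX.1.mulVec_eigenvectorBasis, dotProduct_smul, smul_eq_mul] at h1
  have h2 : ((hX.1.eigenvectorBasis i : ι → ℝ)) ⬝ᵥ (hX.1.eigenvectorBasis i : ι → ℝ) = 1 := by
    have := hX.1.eigenvectorBasis.orthonormal.1 i
    rw [EuclideanSpace.norm_eq] at this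
    have h3 := congrArg (· ^ 2) this
    simp only at h3
    rw [Real.sq_sqrt (Finset.sum_nonneg fun _ _ => sq_nonneg _)] at h3
    simpa [dotProduct, sq] using h3
  rw [h2] at h1
  linarith

/-- For a positive semidefinite form, `N (∑ zⱼ eⱼ) ≤ r ∑ zⱼ² N(eⱼ)`. -/
theorem dotProduct_mulVec_le_card_mul_sum [DecidableEq ι] {N : Matrix ι ι ℝ}
    (hN : N.PosSemidef) (z : ι → ℝ) :
    z ⬝ᵥ N *ᵥ z ≤ Fintype.card ι * ∑ j, z j ^ 2 * N j j := by
  have h1 : ∀ i j, z i * (N i j * z j) ≤ (z i ^ 2 * N i i + z j ^ 2 * N j j) / 2 := by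
    intro i j
    have h := hN.dotProduct_mulVec_nonneg (Pi.single i (z i) - Pi.single j (z j))
    have hs : N j i = N i j := by simpa using hN.1.apply i j
    simp only [star_trivial, Matrix.mulVec_sub, dotProduct_sub, sub_dotProduct,
      single_dotProduct, Matrix.mulVec_single, Pi.smul_apply, MulOpposite.smul_eq_mul_unop,
      MulOpposite.unop_op, Matrix.col_apply, hs] at h
    nlinarith
  calc z ⬝ᵥ N *ᵥ z = ∑ i, ∑ j, z i * (N i j * z j) := by
        simp only [dotProduct, Matrix.mulVec, Finset.mul_sum]
    _ ≤ ∑ i, ∑ j, (z i ^ 2 * N i i + z j ^ 2 * N j j) / 2 :=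
        Finset.sum_le_sum fun i _ => Finset.sum_le_sum fun j _ => h1 i j
    _ = _ := by
        simp only [add_div, Finset.sum_add_distrib, Finset.sum_const, Finset.card_univ,
          nsmul_eq_mul, ← Finset.sum_div, ← Finset.mul_sum]
        ring

end LinearAlgebra

/-! ### The potential -/

section Potential

theorem dotProduct_transpose_mul_mul_mulVec {n ι : Type*} [Fintype n] [Fintype ι]
    (A : Matrix n n ℝ) (D : Matrix n ι ℝ) (y z : ι → ℝ) :
    y ⬝ᵥ (Dᵀ * A * D) *ᵥ z = (D *ᵥ y) ⬝ᵥ A *ᵥ (D *ᵥ z) := by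
  rw [Matrix.mul_assoc, ← Matrix.mulVec_mulVec, ← Matrix.mulVec_mulVec, Matrix.mulVec_transpose,
    dotProduct_comm, ← Matrix.dotProduct_mulVec, dotProduct_comm]

theorem single_dotProduct_mulVec_single {ι : Type*} [Fintype ι] [DecidableEq ι]
    (A : Matrix ι ι ℝ) (j : ι) : Pi.single j 1 ⬝ᵥ A *ᵥ Pi.single j 1 = A j j := by
  simp

variable {n : ℕ} {ι : Type} [Fintype ι]

/-- The Byrd-Nocedal potential of `B` relative to `H`, that is `tr (H⁻¹ B) - log det B`. Up to an
additive constant it is the sum of `λ - log λ` over the eigenvalues `λ` of `H⁻¹ B`, so that it is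
smallest at `B = H`. -/
noncomputable def potential (H B : Matrix (Fin n) (Fin n) ℝ) : ℝ := (H⁻¹ * B).trace - Real.log B.det

/-- The potential is bounded below, with equality at `B = H`. -/
theorem le_potential {H B : Matrix (Fin n) (Fin n) ℝ} (hH : H.PosDef) (hB : B.PosDef) :
    n - Real.log H.det ≤ potential H B := by
  obtain ⟨K, hK, hKH⟩ := exists_normalization hH
  have hX := posDef_transpose_mul_mul hB (mulVec_injective_of_isUnit_det hK)
  have h1 := log_det_le hX
  have hKt : IsUnit Kᵀ.det := by rwa [Matrix.det_transpose]
  have hinv : K * Kᵀ = H⁻¹ := by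
    symm
    apply Matrix.inv_eq_left_inv
    have : K * (Kᵀ * H * K) * K⁻¹ = 1 := by rw [hKH, Matrix.mul_one, Matrix.mul_nonsing_inv _ hK]
    calc K * Kᵀ * H = K * (Kᵀ * H * K) * K⁻¹ := by
          simp only [Matrix.mul_assoc, Matrix.mul_nonsing_inv _ hK, Matrix.mul_one]
      _ = 1 := this
  have htr : (Kᵀ * B * K).trace = (H⁻¹ * B).trace := by
    rw [Matrix.trace_mul_comm, ← Matrix.mul_assoc, hinv]
  have hdet := congrArg Matrix.det hKH
  rw [Matrix.det_mul, Matrix.det_mul, Matrix.det_one] at hdet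
  have hdetX : (Kᵀ * B * K).det * H.det = B.det := by
    rw [Matrix.det_mul, Matrix.det_mul]
    linear_combination B.det * hdet
  have hlog : Real.log B.det = Real.log (Kᵀ * B * K).det + Real.log H.det := by
    rw [← hdetX, Real.log_mul hX.det_pos.ne' hH.det_pos.ne']
  rw [htr, Fintype.card_fin] at h1
  rw [potential, hlog]
  linarith

theorem posDef_of_le_on_range {G H : Matrix (Fin n) (Fin n) ℝ} {D : Matrix (Fin n) ι ℝ}
    (hH : H.PosDef) (hG : Gᵀ = G) (hD : Function.Injective D.mulVec) {γ : ℝ} (hγ : 0 < γ)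
    (hGD : ∀ y, γ * ((D *ᵥ y) ⬝ᵥ H *ᵥ (D *ᵥ y)) ≤ (D *ᵥ y) ⬝ᵥ G *ᵥ (D *ᵥ y)) :
    (Dᵀ * G * D).PosDef := by
  refine Matrix.PosDef.of_dotProduct_mulVec_pos ?_ fun y hy => ?_
  · rw [Matrix.IsHermitian, Matrix.conjTranspose_eq_transpose_of_trivial]
    simp only [Matrix.transpose_mul, Matrix.transpose_transpose, hG, Matrix.mul_assoc]
  · rw [star_trivial, dotProduct_transpose_mul_mul_mulVec]
    refine lt_of_lt_of_le (mul_pos hγ ?_) (hGD y)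
    have hDy : D *ᵥ y ≠ 0 := fun h => hy (hD (by simpa using h))
    simpa using hH.dotProduct_mulVec_pos hDy

/-- The effect of a block update on the potential, in a basis `D R` of the column space of `D` that
is orthonormal for `H` and orthogonal for `B`. The summands are at least `1`, with equality exactly
when `B` and `H` agree on the basis vector. -/
theorem exists_basis_potential_blockUpdate_le [DecidableEq ι] {B G H : Matrix (Fin n) (Fin n) ℝ}
    {D : Matrix (Fin n) ι ℝ} (hB : B.PosDef) (hH : H.PosDef) (hG : Gᵀ = G)
    (hD : Function.Injective D.mulVec) {c γ : ℝ} (hγ : 0 < γ)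
    (hc : ∀ v, (G *ᵥ v) ⬝ᵥ H⁻¹ *ᵥ (G *ᵥ v) ≤ c * (v ⬝ᵥ G *ᵥ v))
    (hGD : ∀ y, γ * ((D *ᵥ y) ⬝ᵥ H *ᵥ (D *ᵥ y)) ≤ (D *ᵥ y) ⬝ᵥ G *ᵥ (D *ᵥ y)) :
    ∃ (R : Matrix ι ι ℝ) (l : ι → ℝ), IsUnit R.det ∧ (D * R)ᵀ * H * (D * R) = 1 ∧
      (D * R)ᵀ * B * (D * R) = Matrix.diagonal l ∧ (∀ j, 0 < l j) ∧
      potential H (blockUpdate B G D) ≤ potential H B + Fintype.card ι * (c - Real.log γ) -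
        ∑ j, (((D * R)ᵀ * (B * H⁻¹ * B) * (D * R)) j j / l j - Real.log (l j)) := by
  obtain ⟨R, l, hR, hRH, hRB, hl⟩ := exists_simultaneous_diagonalization
    (posDef_transpose_mul_mul hH hD) (posDef_transpose_mul_mul hB hD)
  have assoc : ∀ X : Matrix (Fin n) (Fin n) ℝ, (D * R)ᵀ * X * (D * R) = Rᵀ * (Dᵀ * X * D) * R := by
    intro X
    simp only [Matrix.transpose_mul, Matrix.mul_assoc]
  have hinj : Function.Injective (D * R).mulVec := by
    intro y z h
    simp only [← Matrix.mulVec_mulVec] at h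
    exact mulVec_injective_of_isUnit_det hR (hD h)
  set E := D * R with hE
  have hEH : Eᵀ * H * E = 1 := by rw [assoc, hRH]
  have hEB : Eᵀ * B * E = Matrix.diagonal l := by rw [assoc, hRB]
  refine ⟨R, l, hR, hEH, hEB, hl, ?_⟩
  have hGE : ∀ y, γ * ((E *ᵥ y) ⬝ᵥ H *ᵥ (E *ᵥ y)) ≤ (E *ᵥ y) ⬝ᵥ G *ᵥ (E *ᵥ y) := by
    intro y
    rw [hE, ← Matrix.mulVec_mulVec]
    exact hGD _
  have hΓ := posDef_of_le_on_range hH hG hinj hγ hGE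
  have hA := posDef_transpose_mul_mul hB hinj
  have hupd : blockUpdate B G E = blockUpdate B G D := blockUpdate_mul_right B G D hR
  have hpd := posDef_blockUpdate hB hA hG hΓ
  rw [← hupd]
  -- the determinant
  have hdet := det_blockUpdate (isUnit_iff_ne_zero.2 hB.det_pos.ne')
    (isUnit_iff_ne_zero.2 hA.det_pos.ne') (isUnit_iff_ne_zero.2 hΓ.det_pos.ne')
  have hlog := congrArg Real.log hdet
  rw [Real.log_mul hpd.det_pos.ne' hA.det_pos.ne', Real.log_mul hB.det_pos.ne' hΓ.det_pos.ne',
    hEB, Matrix.det_diagonal, Real.log_prod fun i _ => (hl i).ne'] at hlog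
  have hΓlog : Fintype.card ι * Real.log γ ≤ Real.log (Eᵀ * G * E).det := by
    rw [← Real.log_pow]
    refine Real.log_le_log (pow_pos hγ _) (pow_card_le_det hΓ hγ.le fun y => ?_)
    have h := hGE y
    rw [← dotProduct_transpose_mul_mul_mulVec, ← dotProduct_transpose_mul_mul_mulVec, hEH,
      Matrix.one_mulVec] at h
    exact h
  -- the trace of the term that is subtracted
  have htr1 : (H⁻¹ * (B * E * (Eᵀ * B * E)⁻¹ * Eᵀ * B)).trace =
      ∑ j, (Eᵀ * (B * H⁻¹ * B) * E) j j / l j := by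
    have hinv : (Matrix.diagonal l)⁻¹ = Matrix.diagonal fun j => (l j)⁻¹ := by
      apply Matrix.inv_eq_left_inv
      rw [Matrix.diagonal_mul_diagonal, ← Matrix.diagonal_one]
      congr 1
      funext i
      exact inv_mul_cancel₀ (hl i).ne'
    rw [hEB, hinv]
    calc _ = ((H⁻¹ * B * E * Matrix.diagonal fun j => (l j)⁻¹) * (Eᵀ * B)).trace := by
          simp only [Matrix.mul_assoc]
      _ = ((Eᵀ * (B * H⁻¹ * B) * E) * Matrix.diagonal fun j => (l j)⁻¹).trace := by
          rw [Matrix.trace_mul_comm]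
          simp only [Matrix.mul_assoc]
      _ = _ := by simp [Matrix.trace, Matrix.mul_diagonal, div_eq_mul_inv]
  -- the trace of the term that is added, in a basis orthonormal for `G`
  have htr2 : (H⁻¹ * (G * E * (Eᵀ * G * E)⁻¹ * Eᵀ * G)).trace ≤ Fintype.card ι * c := by
    obtain ⟨R', hR', hRG⟩ := exists_normalization hΓ
    have assoc' : (E * R')ᵀ * G * (E * R') = 1 := by
      rw [← hRG]
      simp only [Matrix.transpose_mul, Matrix.mul_assoc]
    rw [← mul_inv_mul_mul_right G E hR', assoc', inv_one, Matrix.mul_one]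
    set F := E * R' with hF
    have hconj : G * H⁻¹ * G = Gᵀ * H⁻¹ * G := by rw [hG]
    calc (H⁻¹ * (G * F * Fᵀ * G)).trace = ((H⁻¹ * G * F) * (Fᵀ * G)).trace := by
          simp only [Matrix.mul_assoc]
      _ = (Fᵀ * (G * H⁻¹ * G) * F).trace := by
          rw [Matrix.trace_mul_comm]
          simp only [Matrix.mul_assoc]
      _ ≤ ∑ _j : ι, c := by
          refine Finset.sum_le_sum fun j _ => ?_
          rw [Matrix.diag_apply, ← single_dotProduct_mulVec_single (Fᵀ * (G * H⁻¹ * G) * F) j,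
            dotProduct_transpose_mul_mul_mulVec, hconj, dotProduct_transpose_mul_mul_mulVec]
          refine (hc _).trans_eq ?_
          rw [← dotProduct_transpose_mul_mul_mulVec, assoc', single_dotProduct_mulVec_single,
            Matrix.one_apply_eq, mul_one]
      _ = Fintype.card ι * c := by simp
  have htrace : (H⁻¹ * blockUpdate B G E).trace = (H⁻¹ * B).trace -
      (H⁻¹ * (B * E * (Eᵀ * B * E)⁻¹ * Eᵀ * B)).trace +
      (H⁻¹ * (G * E * (Eᵀ * G * E)⁻¹ * Eᵀ * G)).trace := by
    rw [blockUpdate, Matrix.mul_add, Matrix.mul_sub, Matrix.trace_add, Matrix.trace_sub]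
  rw [potential, potential, htrace, htr1, Finset.sum_sub_distrib]
  linarith

/-- The squared cosine of the angle between `s` and `B s`. -/
noncomputable def cosSq (B : Matrix (Fin n) (Fin n) ℝ) (s : Fin n → ℝ) : ℝ :=
  (s ⬝ᵥ B *ᵥ s) ^ 2 / ((s ⬝ᵥ s) * ((B *ᵥ s) ⬝ᵥ (B *ᵥ s)))

theorem le_two_mul_sub_log {l u : ℝ} (hl : 0 < l) (hlu : l ≤ u) : u ≤ 2 * (u - Real.log l) := by
  have hu := hl.trans_le hlu
  have h1 := Real.log_le_log hl hlu
  have h2 := Real.log_le_sub_one_of_pos (half_pos hu)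
  rw [Real.log_div hu.ne' two_ne_zero] at h2
  have := Real.log_two_lt_d9
  linarith

theorem one_le_sub_log {l u : ℝ} (hl : 0 < l) (hlu : l ≤ u) : 1 ≤ u - Real.log l := by
  have := Real.log_le_sub_one_of_pos hl
  linarith

/-- If `u - 1 - log l` is small, then so is `u l - 2 l + 1 = (l - 1)² + l (u - l)`. -/
theorem mul_sub_two_mul_add_one_le {l u δ : ℝ} (hl : 0 < l) (hlu : l ≤ u)
    (h : u - 1 - Real.log l ≤ δ) (hδ : δ ≤ 1) : u * l - 2 * l + 1 ≤ 13 * δ := by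
  set t := Real.sqrt l with ht
  have ht0 : 0 < t := Real.sqrt_pos.2 hl
  have htl : t * t = l := Real.mul_self_sqrt hl.le
  have h1 : Real.log l ≤ 2 * (t - 1) := by
    rw [← htl, Real.log_mul ht0.ne' ht0.ne']
    have := Real.log_le_sub_one_of_pos ht0
    linarith
  have h2 : (t - 1) ^ 2 ≤ δ := by nlinarith
  have h3 : u - l ≤ δ := by
    have := Real.log_le_sub_one_of_pos hl
    linarith
  have h4 : t ≤ 2 := by nlinarith
  have h5 : l ≤ 4 := by nlinarith
  have h6 : (l - 1) ^ 2 ≤ 9 * δ := by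
    have : (l - 1) ^ 2 = (t - 1) ^ 2 * (t + 1) ^ 2 := by rw [← htl]; ring
    rw [this]
    have h7 : (t + 1) ^ 2 ≤ 9 := by nlinarith
    nlinarith [sq_nonneg (t - 1)]
  nlinarith

theorem transpose_mul_sub_smul_mul {ι : Type*} (B : Matrix (Fin n) (Fin n) ℝ)
    {H : Matrix (Fin n) (Fin n) ℝ} (hH : H.PosDef)
    (E : Matrix (Fin n) ι ℝ) (t : ℝ) :
    Eᵀ * ((B - t • H) * H⁻¹ * (B - t • H)) * E =
      Eᵀ * (B * H⁻¹ * B) * E - (2 * t) • (Eᵀ * B * E) + t ^ 2 • (Eᵀ * H * E) := by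
  have hu : IsUnit H.det := isUnit_iff_ne_zero.2 hH.det_pos.ne'
  have : (B - t • H) * H⁻¹ * (B - t • H) = B * H⁻¹ * B - (2 * t) • B + t ^ 2 • H := by
    rw [Matrix.sub_mul, Matrix.smul_mul, Matrix.mul_nonsing_inv _ hu, Matrix.sub_mul,
      Matrix.mul_sub, Matrix.mul_smul, Matrix.mul_assoc B H⁻¹ H, Matrix.nonsing_inv_mul _ hu,
      Matrix.mul_one, Matrix.smul_mul, Matrix.one_mul, smul_sub, smul_smul]
    module
  rw [this, Matrix.mul_add, Matrix.mul_sub, Matrix.add_mul, Matrix.sub_mul, Matrix.mul_smul,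
    Matrix.mul_smul, Matrix.smul_mul, Matrix.smul_mul]

theorem posSemidef_mul_inv_mul {C H : Matrix (Fin n) (Fin n) ℝ} (hH : H.PosDef) (hC : Cᵀ = C)
    (E : Matrix (Fin n) ι ℝ) : (Eᵀ * (C * H⁻¹ * C) * E).PosSemidef := by
  refine posSemidef_transpose_mul_mul ?_ E
  have := posSemidef_transpose_mul_mul hH.inv.posSemidef C
  rwa [hC] at this

/-- The Cauchy-Schwarz inequality `(eⱼ · B eⱼ)² ≤ (B eⱼ · H⁻¹ B eⱼ) (eⱼ · H eⱼ)` for the columns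
`eⱼ` of `E`. -/
theorem diagonal_le_of_orthonormal {B H : Matrix (Fin n) (Fin n) ℝ} [DecidableEq ι] (hB : B.PosDef)
    (hH : H.PosDef) {E : Matrix (Fin n) ι ℝ} {l : ι → ℝ} (hEH : Eᵀ * H * E = 1)
    (hEB : Eᵀ * B * E = Matrix.diagonal l) (hl : ∀ j, 0 < l j) (j : ι) :
    l j ≤ (Eᵀ * (B * H⁻¹ * B) * E) j j / l j := by
  have hsymm : (B - l j • H)ᵀ = B - l j • H := by
    rw [Matrix.transpose_sub, Matrix.transpose_smul, transpose_eq_of_posDef hB,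
      transpose_eq_of_posDef hH]
  have h := (posSemidef_mul_inv_mul hH hsymm E).diag_nonneg (i := j)
  rw [transpose_mul_sub_smul_mul B hH, hEH, hEB] at h
  simp only [Matrix.add_apply, Matrix.sub_apply, Matrix.smul_apply, Matrix.diagonal_apply_eq,
    Matrix.one_apply_eq, smul_eq_mul] at h
  rw [le_div_iff₀ (hl j)]
  nlinarith

/-- A small angle cosine for a vector in the column space of `D` forces the potential to drop. -/
theorem exp_potential_blockUpdate_le [DecidableEq ι] {B G : Matrix (Fin n) (Fin n) ℝ}
    {D : Matrix (Fin n) ι ℝ} (hB : B.PosDef) (hG : Gᵀ = G)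
    (hD : Function.Injective D.mulVec) {c γ : ℝ} (hγ : 0 < γ)
    (hc : ∀ v, (G *ᵥ v) ⬝ᵥ (G *ᵥ v) ≤ c * (v ⬝ᵥ G *ᵥ v))
    (hGD : ∀ y, γ * ((D *ᵥ y) ⬝ᵥ (D *ᵥ y)) ≤ (D *ᵥ y) ⬝ᵥ G *ᵥ (D *ᵥ y))
    {y : ι → ℝ} (hy : y ≠ 0) :
    Real.exp (2 * (potential 1 (blockUpdate B G D) - potential 1 B -
      Fintype.card ι * (c - Real.log γ))) ≤ 2 * Fintype.card ι * cosSq B (D *ᵥ y) := by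
  obtain ⟨R, l, hR, hEH, hEB, hl, hpot⟩ := exists_basis_potential_blockUpdate_le hB
    Matrix.PosDef.one hG hD hγ (by simpa using hc) (by simpa using hGD)
  set E := D * R with hE
  set u := fun j => (Eᵀ * (B * (1 : Matrix (Fin n) (Fin n) ℝ)⁻¹ * B) * E) j j / l j with hu
  have hlu : ∀ j, l j ≤ u j := diagonal_le_of_orthonormal hB Matrix.PosDef.one hEH hEB hl
  set Θ := ∑ j, (u j - Real.log (l j)) with hΘ
  have hΘj : ∀ j, u j - Real.log (l j) ≤ Θ := fun j =>
    Finset.single_le_sum (f := fun j => u j - Real.log (l j))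
      (fun i _ => zero_le_one.trans (one_le_sub_log (hl i) (hlu i))) (Finset.mem_univ j)
  -- coordinates of `s = D y` in the basis
  set z := R⁻¹ *ᵥ y with hz
  have hs : E *ᵥ z = D *ᵥ y := by
    rw [hE, hz, Matrix.mulVec_mulVec, Matrix.mul_assoc, Matrix.mul_nonsing_inv _ hR, Matrix.mul_one]
  have hz0 : z ≠ 0 := by
    intro h
    apply hy
    apply hD
    rw [← hs, h, Matrix.mulVec_zero, Matrix.mulVec_zero]
  obtain ⟨j₀, hj₀⟩ := Function.ne_iff.1 hz0
  have hΘ1 : 1 ≤ Θ := (one_le_sub_log (hl j₀) (hlu j₀)).trans (hΘj j₀)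
  have hss : (D *ᵥ y) ⬝ᵥ (D *ᵥ y) = ∑ j, z j ^ 2 := by
    have := dotProduct_transpose_mul_mul_mulVec 1 E z z
    rw [hEH, Matrix.one_mulVec, Matrix.one_mulVec, hs] at this
    rw [← this]
    simp [dotProduct, sq]
  have hsBs : (D *ᵥ y) ⬝ᵥ B *ᵥ (D *ᵥ y) = ∑ j, z j ^ 2 * l j := by
    rw [← hs, ← dotProduct_transpose_mul_mul_mulVec, hEB]
    simp only [dotProduct, Matrix.mulVec_diagonal]
    exact Finset.sum_congr rfl fun j _ => by ring
  have hBsBs : (B *ᵥ (D *ᵥ y)) ⬝ᵥ (B *ᵥ (D *ᵥ y)) ≤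
      Fintype.card ι * (2 * Θ) * ∑ j, z j ^ 2 * l j := by
    have h1 := dotProduct_mulVec_le_card_mul_sum
      (posSemidef_mul_inv_mul Matrix.PosDef.one (transpose_eq_of_posDef hB) E) z
    have hconj : B * (1 : Matrix (Fin n) (Fin n) ℝ)⁻¹ * B = Bᵀ * 1 * B := by
      rw [transpose_eq_of_posDef hB, inv_one]
    rw [dotProduct_transpose_mul_mul_mulVec, hs] at h1
    rw [hconj, dotProduct_transpose_mul_mul_mulVec, Matrix.one_mulVec, ← hconj] at h1
    refine h1.trans ((mul_le_mul_of_nonneg_left ?_ (Nat.cast_nonneg _)).trans_eq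
      (mul_assoc _ _ _).symm)
    rw [Finset.mul_sum]
    refine Finset.sum_le_sum fun j _ => ?_
    have h2 : (Eᵀ * (B * (1 : Matrix (Fin n) (Fin n) ℝ)⁻¹ * B) * E) j j = u j * l j := by
      rw [hu]
      field_simp [(hl j).ne']
    have h3 : u j ≤ 2 * Θ := (le_two_mul_sub_log (hl j) (hlu j)).trans (by linarith [hΘj j])
    rw [h2]
    have := mul_le_mul_of_nonneg_right h3 (mul_nonneg (sq_nonneg (z j)) (hl j).le)
    linarith
  have hsum : Real.exp (-Θ) * ∑ j, z j ^ 2 ≤ ∑ j, z j ^ 2 * l j := by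
    rw [Finset.mul_sum]
    refine Finset.sum_le_sum fun j _ => ?_
    rw [mul_comm]
    refine mul_le_mul_of_nonneg_left ?_ (sq_nonneg _)
    rw [← Real.le_log_iff_exp_le (hl j)]
    linarith [hΘj j, hlu j, hl j]
  have hP : 0 < ∑ j, z j ^ 2 := by
    refine Finset.sum_pos' (fun _ _ => sq_nonneg _) ⟨j₀, Finset.mem_univ _, ?_⟩
    exact sq_pos_of_ne_zero hj₀
  have hQ : 0 < ∑ j, z j ^ 2 * l j := lt_of_lt_of_le (mul_pos (Real.exp_pos _) hP) hsum
  have hBs : 0 < (B *ᵥ (D *ᵥ y)) ⬝ᵥ (B *ᵥ (D *ᵥ y)) := by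
    refine lt_of_le_of_ne (Finset.sum_nonneg fun _ _ => mul_self_nonneg _) fun h => ?_
    rw [dotProduct_self_eq_zero.1 h.symm, dotProduct_zero] at hsBs
    linarith
  have hcard : (0 : ℝ) < Fintype.card ι := Nat.cast_pos.2 (Fintype.card_pos_iff.2 ⟨j₀⟩)
  rw [cosSq, hss, hsBs]
  calc _ ≤ Real.exp (-Θ) * Real.exp (-Θ) := by
        rw [← Real.exp_add]
        apply Real.exp_le_exp.2
        linarith
    _ ≤ _ := by
        rw [mul_div_assoc', le_div_iff₀ (mul_pos hP hBs)]
        have hexp : Θ * Real.exp (-Θ) ≤ 1 := by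
          rw [Real.exp_neg, ← div_eq_mul_inv, div_le_one (Real.exp_pos _)]
          linarith [Real.add_one_le_exp Θ]
        have e0 := (Real.exp_pos (-Θ)).le
        calc Real.exp (-Θ) * Real.exp (-Θ) * ((∑ j, z j ^ 2) *
              ((B *ᵥ (D *ᵥ y)) ⬝ᵥ (B *ᵥ (D *ᵥ y))))
            ≤ Real.exp (-Θ) * Real.exp (-Θ) * ((∑ j, z j ^ 2) *
              (Fintype.card ι * (2 * Θ) * ∑ j, z j ^ 2 * l j)) := by gcongr
          _ = 2 * Fintype.card ι * ((Θ * Real.exp (-Θ)) * ((Real.exp (-Θ) * ∑ j, z j ^ 2) *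
              ∑ j, z j ^ 2 * l j)) := by ring
          _ ≤ 2 * Fintype.card ι * (1 * ((∑ j, z j ^ 2 * l j) * ∑ j, z j ^ 2 * l j)) := by
              gcongr
          _ = _ := by ring

/-- If the potential relative to `H` does not drop, then `B` is close to `H` on the column space
of `D`. -/
theorem dotProduct_sub_mulVec_le [DecidableEq ι] {B G H : Matrix (Fin n) (Fin n) ℝ}
    {D : Matrix (Fin n) ι ℝ} (hB : B.PosDef) (hH : H.PosDef) (hG : Gᵀ = G)
    (hD : Function.Injective D.mulVec) {c γ δ : ℝ} (hγ : 0 < γ)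
    (hc : ∀ v, (G *ᵥ v) ⬝ᵥ H⁻¹ *ᵥ (G *ᵥ v) ≤ c * (v ⬝ᵥ G *ᵥ v))
    (hGD : ∀ y, γ * ((D *ᵥ y) ⬝ᵥ H *ᵥ (D *ᵥ y)) ≤ (D *ᵥ y) ⬝ᵥ G *ᵥ (D *ᵥ y))
    (hδ : potential H B - potential H (blockUpdate B G D) +
      Fintype.card ι * (c - 1 - Real.log γ) ≤ δ) (hδ1 : δ ≤ 1) (y : ι → ℝ) :
    ((B - H) *ᵥ (D *ᵥ y)) ⬝ᵥ H⁻¹ *ᵥ ((B - H) *ᵥ (D *ᵥ y)) ≤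
      13 * Fintype.card ι * δ * ((D *ᵥ y) ⬝ᵥ H *ᵥ (D *ᵥ y)) := by
  obtain ⟨R, l, hR, hEH, hEB, hl, hpot⟩ := exists_basis_potential_blockUpdate_le hB hH hG hD hγ
    hc hGD
  set E := D * R with hE
  set u := fun j => (Eᵀ * (B * H⁻¹ * B) * E) j j / l j with hu
  have hlu : ∀ j, l j ≤ u j := diagonal_le_of_orthonormal hB hH hEH hEB hl
  have hδj : ∀ j, u j - 1 - Real.log (l j) ≤ δ := by
    intro j
    have h1 := Finset.single_le_sum (f := fun j => u j - Real.log (l j) - 1)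
      (fun i _ => sub_nonneg.2 (one_le_sub_log (hl i) (hlu i))) (Finset.mem_univ j)
    rw [Finset.sum_sub_distrib, Finset.sum_const, Finset.card_univ, nsmul_eq_mul] at h1
    simp only [hu] at h1 ⊢
    linarith
  set z := R⁻¹ *ᵥ y with hz
  have hs : E *ᵥ z = D *ᵥ y := by
    rw [hE, hz, Matrix.mulVec_mulVec, Matrix.mul_assoc, Matrix.mul_nonsing_inv _ hR, Matrix.mul_one]
  have hsymm : (B - H)ᵀ = B - H := by
    rw [Matrix.transpose_sub, transpose_eq_of_posDef hB, transpose_eq_of_posDef hH]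
  have h1 := dotProduct_mulVec_le_card_mul_sum (posSemidef_mul_inv_mul hH hsymm E) z
  have hconj : (B - H) * H⁻¹ * (B - H) = (B - H)ᵀ * H⁻¹ * (B - H) := by rw [hsymm]
  rw [dotProduct_transpose_mul_mul_mulVec, hs] at h1
  nth_rw 1 [hconj] at h1
  rw [dotProduct_transpose_mul_mul_mulVec] at h1
  have hsHs : (D *ᵥ y) ⬝ᵥ H *ᵥ (D *ᵥ y) = ∑ j, z j ^ 2 := by
    rw [← hs, ← dotProduct_transpose_mul_mul_mulVec, hEH, Matrix.one_mulVec]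
    simp [dotProduct, sq]
  refine h1.trans ?_
  rw [hsHs]
  calc _ ≤ (Fintype.card ι : ℝ) * ∑ j, z j ^ 2 * (13 * δ) := by
        gcongr with j
        have h2 := congrFun (congrFun (transpose_mul_sub_smul_mul B hH E 1) j) j
        rw [one_smul, hEH, hEB] at h2
        rw [h2]
        simp only [Matrix.add_apply, Matrix.sub_apply, Matrix.smul_apply, Matrix.diagonal_apply_eq,
          Matrix.one_apply_eq, smul_eq_mul]
        have h3 : (Eᵀ * (B * H⁻¹ * B) * E) j j = u j * l j := by
          rw [hu]
          field_simp [(hl j).ne']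
        rw [h3]
        have := mul_sub_two_mul_add_one_le (hl j) (hlu j) (hδj j) hδ1
        linarith
    _ = _ := by
        rw [← Finset.sum_mul]
        ring

end Potential

/-! ### The filtering procedure -/

section Filtering

open scoped InnerProductSpace

variable {V : Type*} [NormedAddCommGroup V] [InnerProductSpace ℝ V] {q : ℕ}

/-- The invariant of the filtering loop. Here `l` lists the columns that are still to be examined;
the vectors `d p` are the `T`-orthogonalized retained columns, whose squared `T`-norms are the
pivots, and `T` is bounded below by `1 / K` on their span. -/
structure FilterInvariant (T : V →L[ℝ] V) (s : Fin q → V) (st : FilterState q)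
    (l : List (Fin q)) (K : ℝ) (d : Fin q → V) : Prop where
  orthogonal : ∀ p ∈ st.kept, ∀ r ∈ st.kept, p ≠ r → ⟪d p, T (d r)⟫_ℝ = 0
  pivot_eq : ∀ p ∈ st.kept, ⟪d p, T (d p)⟫_ℝ = st.Sig p
  pivot_pos : ∀ p ∈ st.kept, 0 < st.Sig p
  lt_of_mem : ∀ p ∈ st.kept, ∀ j ∈ l, p < j
  coeff_eq : ∀ p ∈ st.kept, ∀ j ∈ l, ⟪s j, T (d p)⟫_ℝ = st.L j p * st.Sig p
  mem_span : ∀ p ∈ st.kept, s p ∈ Submodule.span ℝ (d '' st.kept)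
  linearIndepOn : LinearIndepOn ℝ s (st.kept : Set (Fin q))
  bound : ∀ w ∈ Submodule.span ℝ (d '' st.kept), ‖w‖ ^ 2 ≤ K * ⟪w, T w⟫_ℝ

theorem FilterInvariant.init (T : V →L[ℝ] V) (s : Fin q → V) (l : List (Fin q)) (K : ℝ) :
    FilterInvariant T s { kept := ∅, L := 0, Sig := 0 } l K 0 where
  orthogonal := by simp
  pivot_eq := by simp
  pivot_pos := by simp
  lt_of_mem := by simp
  coeff_eq := by simp
  mem_span := by simp
  linearIndepOn := by simp
  bound := by simp

/-- Appending a column whose pivot is large keeps `T` elliptic on the span. -/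
theorem norm_sq_add_smul_le {T : V →L[ℝ] V} (hsymm : ∀ x y, ⟪x, T y⟫_ℝ = ⟪y, T x⟫_ℝ)
    (hpos : ∀ x, 0 ≤ ⟪x, T x⟫_ℝ) {M τ K c : ℝ} (hτ : 0 < τ) (hM0 : 0 ≤ M) (hK : 0 ≤ K)
    (hM : ∀ x, ⟪x, T x⟫_ℝ ≤ M * ‖x‖ ^ 2) {w s : V} (hw : ‖w‖ ^ 2 ≤ K * ⟪w, T w⟫_ℝ)
    (hs : c ^ 2 * (τ * ‖s‖ ^ 2) ≤ ⟪w + c • s, T (w + c • s)⟫_ℝ) :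
    ‖w + c • s‖ ^ 2 ≤ (4 * K * (1 + M / τ) + 2 / τ) * ⟪w + c • s, T (w + c • s)⟫_ℝ := by
  set Q := ⟪w + c • s, T (w + c • s)⟫_ℝ with hQ
  have h1 : ⟪w, T w⟫_ℝ ≤ 2 * Q + 2 * (c ^ 2 * ⟪s, T s⟫_ℝ) := by
    have h := hpos (w + (2 * c) • s)
    have e := hsymm s w
    simp only [hQ, map_add, map_smul, inner_add_left, inner_add_right, real_inner_smul_left,
      real_inner_smul_right] at h ⊢
    rw [e] at h ⊢
    nlinarith
  have h2 : c ^ 2 * ‖s‖ ^ 2 ≤ Q / τ := by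
    rw [le_div_iff₀ hτ]
    linarith
  have h3 : c ^ 2 * ⟪s, T s⟫_ℝ ≤ M / τ * Q := by
    calc c ^ 2 * ⟪s, T s⟫_ℝ ≤ c ^ 2 * (M * ‖s‖ ^ 2) := by
          have := hM s
          gcongr
      _ = M * (c ^ 2 * ‖s‖ ^ 2) := by ring
      _ ≤ M * (Q / τ) := by gcongr
      _ = M / τ * Q := by ring
  have h4 : ‖w + c • s‖ ^ 2 ≤ 2 * ‖w‖ ^ 2 + 2 * (c ^ 2 * ‖s‖ ^ 2) := by
    have := parallelogram_law_with_norm ℝ w (c • s)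
    have e : ‖c • s‖ ^ 2 = c ^ 2 * ‖s‖ ^ 2 := by
      rw [norm_smul, mul_pow, Real.norm_eq_abs, sq_abs]
    nlinarith [norm_nonneg (w - c • s)]
  calc ‖w + c • s‖ ^ 2 ≤ 2 * ‖w‖ ^ 2 + 2 * (c ^ 2 * ‖s‖ ^ 2) := h4
    _ ≤ 2 * (K * (2 * Q + 2 * (M / τ * Q))) + 2 * (Q / τ) := by
        have : K * ⟪w, T w⟫_ℝ ≤ K * (2 * Q + 2 * (M / τ * Q)) := by
          gcongr
          linarith
        linarith
    _ = _ := by ring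

/-- The ellipticity constant of the retained columns after a given number of passes. -/
noncomputable def filterConst (τ M : ℝ) : ℕ → ℝ
  | 0 => 1
  | k + 1 => 4 * filterConst τ M k * (1 + M / τ) + 2 / τ

theorem one_le_filterConst {τ M : ℝ} (hτ : 0 < τ) (hM : 0 ≤ M) (k : ℕ) :
    1 ≤ filterConst τ M k := by
  induction k with
  | zero => exact le_rfl
  | succ k ih =>
    have h1 : 0 ≤ M / τ := by positivity
    have h2 : 0 ≤ 2 / τ := by positivity
    rw [filterConst]
    nlinarith

theorem filterConst_le_succ {τ M : ℝ} (hτ : 0 < τ) (hM : 0 ≤ M) (k : ℕ) :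
    filterConst τ M k ≤ filterConst τ M (k + 1) := by
  have h0 := one_le_filterConst hτ hM k
  have h1 : 0 ≤ M / τ := by positivity
  have h2 : 0 ≤ 2 / τ := by positivity
  rw [filterConst]
  nlinarith

/-- A pass that retains the column `i` preserves the invariant: it appends the component of `s i`
that is `T`-orthogonal to the retained columns. -/
theorem FilterInvariant.pass {n : ℕ} {T : Vec n →L[ℝ] Vec n}
    (hsymm : ∀ x y, ⟪x, T y⟫_ℝ = ⟪y, T x⟫_ℝ) (hpos : ∀ x, 0 ≤ ⟪x, T x⟫_ℝ) {M τ K : ℝ}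
    (hτ : 0 < τ) (hM0 : 0 ≤ M) (hK : 0 ≤ K) (hM : ∀ x, ⟪x, T x⟫_ℝ ≤ M * ‖x‖ ^ 2)
    {s : Fin q → Vec n} (hs : ∀ i, s i ≠ 0) {A : Matrix (Fin q) (Fin q) ℝ}
    (hA : ∀ i j, A i j = ⟪s i, T (s j)⟫_ℝ) {st : FilterState q} {i : Fin q} {l : List (Fin q)}
    (hl : ∀ j ∈ l, i < j) {d : Fin q → Vec n} (h : FilterInvariant T s st (i :: l) K d)
    (hkeep : τ * ‖s i‖ ^ 2 ≤ st.pivot A i) :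
    FilterInvariant T s (filterPass τ s A st i) l (4 * K * (1 + M / τ) + 2 / τ)
      (Function.update d i (s i - ∑ p ∈ st.kept, st.L i p • d p)) := by
  have hi : i ∉ st.kept := fun hi => lt_irrefl _ (h.lt_of_mem i hi i (by simp))
  have hne : ∀ p ∈ st.kept, p ≠ i := fun p hp e => hi (e ▸ hp)
  set di := s i - ∑ p ∈ st.kept, st.L i p • d p with hdi
  set d' := Function.update d i di with hd'
  have hd'i : d' i = di := Function.update_self ..
  have hd'p : ∀ p ∈ st.kept, d' p = d p := fun p hp => Function.update_of_ne (hne p hp) ..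
  -- the new vector is orthogonal to the old ones
  have horth : ∀ r ∈ st.kept, ⟪di, T (d r)⟫_ℝ = 0 := by
    intro r hr
    rw [hdi, inner_sub_left, sum_inner, h.coeff_eq r hr i (by simp),
      Finset.sum_eq_single_of_mem r hr]
    · rw [real_inner_smul_left, h.pivot_eq r hr, sub_self]
    · intro p hp hpr
      rw [real_inner_smul_left, h.orthogonal p hp r hr hpr, mul_zero]
  have horth' : ∀ r ∈ st.kept, ⟪d r, T di⟫_ℝ = 0 := fun r hr => by rw [hsymm, horth r hr]
  have hsdi : ∀ j, ⟪s j, T di⟫_ℝ = A j i - ∑ p ∈ st.kept, st.L i p * ⟪s j, T (d p)⟫_ℝ := by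
    intro j
    simp only [hdi, map_sub, map_sum, map_smul, inner_sub_right, inner_sum, real_inner_smul_right,
      hA]
  have hpiv : ⟪di, T di⟫_ℝ = st.pivot A i := by
    have h1 : ⟪di, T di⟫_ℝ = ⟪s i, T di⟫_ℝ := by
      conv_lhs => rw [hdi, inner_sub_left, sum_inner, ← hdi]
      rw [Finset.sum_eq_zero, sub_zero]
      intro p hp
      rw [real_inner_smul_left, horth' p hp, mul_zero]
    rw [h1, hsdi, FilterState.pivot]
    congr 1
    refine Finset.sum_congr rfl fun p hp => ?_
    rw [h.coeff_eq p hp i (by simp)]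
    ring
  have hpivpos : 0 < st.pivot A i :=
    lt_of_lt_of_le (mul_pos hτ (pow_pos (norm_pos_iff.2 (hs i)) 2)) hkeep
  have hspan : Submodule.span ℝ (d' '' (insert i st.kept : Finset (Fin q))) =
      Submodule.span ℝ {di} ⊔ Submodule.span ℝ (d '' st.kept) := by
    rw [Finset.coe_insert, Set.image_insert_eq, hd'i, Submodule.span_insert]
    congr 2
    exact Set.image_congr hd'p
  have hcombo : ∑ p ∈ st.kept, st.L i p • d p ∈ Submodule.span ℝ (d '' st.kept) :=
    Submodule.sum_mem _ fun p hp => Submodule.smul_mem _ _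
      (Submodule.subset_span ⟨p, hp, rfl⟩)
  have horthW : ∀ w ∈ Submodule.span ℝ (d '' st.kept), ⟪w, T di⟫_ℝ = 0 := by
    intro w hw
    induction hw using Submodule.span_induction with
    | mem x hx =>
      obtain ⟨p, hp, rfl⟩ := hx
      exact horth' p hp
    | zero => simp
    | add x y _ _ hx hy => rw [inner_add_left, hx, hy, add_zero]
    | smul a x _ hx => rw [real_inner_smul_left, hx, mul_zero]
  rw [filterPass, if_pos hkeep]
  refine ⟨?_, ?_, ?_, ?_, ?_, ?_, ?_, ?_⟩
  · intro p hp r hr hpr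
    rcases Finset.mem_insert.1 hp with hpi | hp' <;> rcases Finset.mem_insert.1 hr with hri | hr'
    · exact absurd (hpi.trans hri.symm) hpr
    · rw [hpi, hd'i, hd'p r hr', horth r hr']
    · rw [hri, hd'i, hd'p p hp', horth' p hp']
    · rw [hd'p p hp', hd'p r hr', h.orthogonal p hp' r hr' hpr]
  · intro p hp
    rcases Finset.mem_insert.1 hp with rfl | hp
    · simp only [Function.update_self, hd'i, hpiv]
    · simp only [hd'p p hp, Function.update_of_ne (hne p hp), h.pivot_eq p hp]
  · intro p hp
    rcases Finset.mem_insert.1 hp with rfl | hp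
    · simpa only [Function.update_self] using hpivpos
    · simpa only [Function.update_of_ne (hne p hp)] using h.pivot_pos p hp
  · intro p hp j hj
    rcases Finset.mem_insert.1 hp with rfl | hp
    · exact hl j hj
    · exact h.lt_of_mem p hp j (List.mem_cons_of_mem _ hj)
  · intro p hp j hj
    rcases Finset.mem_insert.1 hp with rfl | hp
    · have hj' := hl j hj
      simp only [hd'i, hsdi, Function.update_self, Matrix.of_apply, if_true, hj', hj'.ne', if_false]
      rw [one_div, mul_assoc, mul_comm _ (st.pivot A p), inv_mul_cancel_left₀ hpivpos.ne']
      congr 1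
      refine Finset.sum_congr rfl fun r hr => ?_
      rw [h.coeff_eq r hr j (List.mem_cons_of_mem _ hj)]
      ring
    · simp only [hd'p p hp, Function.update_of_ne (hne p hp), Matrix.of_apply, hne p hp, if_false]
      exact h.coeff_eq p hp j (List.mem_cons_of_mem _ hj)
  · intro p hp
    simp only [hspan]
    rcases Finset.mem_insert.1 hp with rfl | hp
    · have : s p = di + ∑ r ∈ st.kept, st.L p r • d r := by rw [hdi, sub_add_cancel]
      rw [this]
      exact Submodule.add_mem_sup (Submodule.mem_span_singleton_self _) hcombo
    · exact Submodule.mem_sup_right (h.mem_span p hp)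
  · simp only [Finset.coe_insert]
    refine h.linearIndepOn.insert fun hmem => ?_
    have h1 : s i ∈ Submodule.span ℝ (d '' st.kept) := by
      refine Submodule.span_le.2 ?_ hmem
      rintro _ ⟨p, hp, rfl⟩
      exact h.mem_span p hp
    have h2 : di ∈ Submodule.span ℝ (d '' st.kept) := Submodule.sub_mem _ h1 hcombo
    have h3 := horthW di h2
    rw [hpiv] at h3
    exact hpivpos.ne' h3
  · intro w hw
    simp only [hspan] at hw
    obtain ⟨a, ha, b, hb, rfl⟩ := Submodule.mem_sup.1 hw
    obtain ⟨c, rfl⟩ := Submodule.mem_span_singleton.1 ha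
    set w' := b - c • ∑ r ∈ st.kept, st.L i r • d r with hw'
    have hw'mem : w' ∈ Submodule.span ℝ (d '' st.kept) :=
      Submodule.sub_mem _ hb (Submodule.smul_mem _ _ hcombo)
    have e : c • di + b = w' + c • s i := by
      rw [hw', hdi, smul_sub]
      abel
    rw [e]
    refine norm_sq_add_smul_le hsymm hpos hτ hM0 hK hM (h.bound w' hw'mem) ?_
    rw [← e]
    have h1 : ⟪c • di + b, T (c • di + b)⟫_ℝ = c ^ 2 * st.pivot A i + ⟪b, T b⟫_ℝ := by
      have h2 := horthW b hb
      simp only [map_add, map_smul, inner_add_left, inner_add_right, real_inner_smul_left,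
        real_inner_smul_right, h2, hsymm di b, hpiv]
      ring
    rw [h1]
    have h3 := mul_le_mul_of_nonneg_left hkeep (sq_nonneg c)
    linarith [hpos b]

theorem exists_filterInvariant_foldl {n : ℕ} {T : Vec n →L[ℝ] Vec n}
    (hsymm : ∀ x y, ⟪x, T y⟫_ℝ = ⟪y, T x⟫_ℝ) (hpos : ∀ x, 0 ≤ ⟪x, T x⟫_ℝ) {M τ : ℝ}
    (hτ : 0 < τ) (hM0 : 0 ≤ M) (hM : ∀ x, ⟪x, T x⟫_ℝ ≤ M * ‖x‖ ^ 2)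
    {s : Fin q → Vec n} (hs : ∀ i, s i ≠ 0) {A : Matrix (Fin q) (Fin q) ℝ}
    (hA : ∀ i j, A i j = ⟪s i, T (s j)⟫_ℝ) (l : List (Fin q)) (hl : l.Pairwise (· < ·))
    (st : FilterState q) (k : ℕ) (d : Fin q → Vec n)
    (h : FilterInvariant T s st l (filterConst τ M k) d) :
    ∃ d', FilterInvariant T s (l.foldl (filterPass τ s A) st) [] (filterConst τ M (k + l.length))
      d' := by
  induction l generalizing st k d with
  | nil => exact ⟨d, h⟩
  | cons i l ih =>
    rw [List.pairwise_cons] at hl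
    have hstep : ∃ d',
        FilterInvariant T s (filterPass τ s A st i) l (filterConst τ M (k + 1)) d' := by
      by_cases hkeep : τ * ‖s i‖ ^ 2 ≤ st.pivot A i
      · exact ⟨_, h.pass hsymm hpos hτ hM0 (zero_le_one.trans (one_le_filterConst hτ hM0 k)) hM hs
          hA hl.1 hkeep⟩
      · rw [filterPass, if_neg hkeep]
        refine ⟨d, h.orthogonal, h.pivot_eq, h.pivot_pos, fun p hp j hj => h.lt_of_mem p hp j
          (List.mem_cons_of_mem _ hj), fun p hp j hj => h.coeff_eq p hp j
          (List.mem_cons_of_mem _ hj), h.mem_span, h.linearIndepOn, fun w hw => ?_⟩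
        exact (h.bound w hw).trans
          (mul_le_mul_of_nonneg_right (filterConst_le_succ hτ hM0 k) (hpos w))
    obtain ⟨d', hd'⟩ := hstep
    have := ih hl.2 _ (k + 1) d' hd'
    rwa [List.length_cons, ← add_assoc, add_right_comm]

theorem transpose_colMatrix_mul_mul_apply {n : ℕ} {ι : Type} (s : ι → Vec n)
    (G : Matrix (Fin n) (Fin n) ℝ) (i j : ι) :
    ((colMatrix s)ᵀ * G * colMatrix s) i j =
      ⟪s i, Matrix.toEuclideanCLM (n := Fin n) (𝕜 := ℝ) G (s j)⟫_ℝ := by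
  rw [Matrix.inner_toEuclideanCLM, Matrix.mul_assoc]
  rfl

theorem colMatrix_mulVec {n : ℕ} {ι : Type} [Fintype ι] (s : ι → Vec n) (y : ι → ℝ) :
    colMatrix s *ᵥ y = (∑ i, y i • s i : Vec n).ofLp := by
  funext r
  simp [colMatrix, Matrix.mulVec, dotProduct, mul_comm]

/-- The retained columns are linearly independent, and `G` is bounded below on their span by a
constant that only depends on `τ`, `M` and the number of columns. -/
theorem filterSteps_spec {n : ℕ} {G : Matrix (Fin n) (Fin n) ℝ} (hG : G.PosSemidef) {M τ : ℝ}
    (hτ : 0 < τ) (hM0 : 0 ≤ M) (hM : ∀ x : Fin n → ℝ, x ⬝ᵥ G *ᵥ x ≤ M * (x ⬝ᵥ x))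
    {s : Fin q → Vec n} (hs : ∀ i, s i ≠ 0) :
    Function.Injective (colMatrix fun i : filterSteps τ s G => s i).mulVec ∧
      ∀ y, (filterConst τ M q)⁻¹ * (((colMatrix fun i : filterSteps τ s G => s i) *ᵥ y) ⬝ᵥ
          ((colMatrix fun i : filterSteps τ s G => s i) *ᵥ y)) ≤
        ((colMatrix fun i : filterSteps τ s G => s i) *ᵥ y) ⬝ᵥ
          G *ᵥ ((colMatrix fun i : filterSteps τ s G => s i) *ᵥ y) := by
  set T := Matrix.toEuclideanCLM (n := Fin n) (𝕜 := ℝ) G with hT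
  have hsymm : ∀ x y, ⟪x, T y⟫_ℝ = ⟪y, T x⟫_ℝ := by
    intro x y
    rw [hT, Matrix.inner_toEuclideanCLM, Matrix.inner_toEuclideanCLM, Matrix.dotProduct_mulVec,
      dotProduct_comm, ← Matrix.mulVec_transpose]
    have : Gᵀ = G := by simpa using hG.1.eq
    rw [this]
  have hpos : ∀ x, 0 ≤ ⟪x, T x⟫_ℝ := by
    intro x
    rw [hT, Matrix.inner_toEuclideanCLM]
    simpa using hG.dotProduct_mulVec_nonneg x
  have hnorm : ∀ x : Vec n, ‖x‖ ^ 2 = x ⬝ᵥ x := by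
    intro x
    rw [EuclideanSpace.real_norm_sq_eq]
    simp [dotProduct, sq]
  have hM' : ∀ x, ⟪x, T x⟫_ℝ ≤ M * ‖x‖ ^ 2 := by
    intro x
    rw [hT, Matrix.inner_toEuclideanCLM, hnorm]
    exact hM x
  obtain ⟨d, hd⟩ := exists_filterInvariant_foldl hsymm hpos hτ hM0 hM' hs
    (transpose_colMatrix_mul_mul_apply s G) (List.finRange q) (List.pairwise_lt_finRange q)
    { kept := ∅, L := 0, Sig := 0 } 0 0 (FilterInvariant.init T s _ _)
  rw [List.length_finRange, zero_add] at hd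
  change FilterInvariant T s _ _ _ _ at hd
  constructor
  · intro y z hyz
    rw [colMatrix_mulVec, colMatrix_mulVec] at hyz
    have h1 : LinearIndependent ℝ fun i : filterSteps τ s G => s i := hd.linearIndepOn
    have h2 := WithLp.ofLp_injective 2 hyz
    rw [linearIndependent_iff_injective_fintypeLinearCombination] at h1
    exact h1 (by simpa [Fintype.linearCombination_apply] using h2)
  · intro y
    have hpos' : 0 < filterConst τ M q := zero_lt_one.trans_le (one_le_filterConst hτ hM0 q)
    rw [inv_mul_le_iff₀ hpos', colMatrix_mulVec, ← hnorm, ← Matrix.inner_toEuclideanCLM]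
    refine hd.bound _ (Submodule.sum_mem _ fun i _ => Submodule.smul_mem _ _ ?_)
    exact hd.mem_span i i.2

theorem kept_subset_foldl {n : ℕ} (τ : ℝ) (s : Fin q → Vec n) (A : Matrix (Fin q) (Fin q) ℝ)
    (l : List (Fin q)) (st : FilterState q) : st.kept ⊆ (l.foldl (filterPass τ s A) st).kept := by
  induction l generalizing st with
  | nil => exact subset_rfl
  | cons i l ih =>
    refine Finset.Subset.trans ?_ (ih _)
    rw [filterPass]
    split_ifs
    · exact Finset.subset_insert _ _
    · exact subset_rfl

/-- The first column is retained as soon as `G ⪰ τ I`. -/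
theorem filterSteps_nonempty {n : ℕ} {G : Matrix (Fin n) (Fin n) ℝ} {τ : ℝ} (hq : 1 ≤ q)
    (hG : ∀ x : Fin n → ℝ, τ * (x ⬝ᵥ x) ≤ x ⬝ᵥ G *ᵥ x) (s : Fin q → Vec n) :
    (filterSteps τ s G).Nonempty := by
  obtain ⟨k, rfl⟩ : ∃ k, q = k + 1 := ⟨q - 1, by omega⟩
  refine ⟨0, ?_⟩
  rw [filterSteps, List.finRange_succ, List.foldl_cons]
  apply kept_subset_foldl
  rw [filterPass, if_pos]
  · simp
  · rw [FilterState.pivot, transpose_colMatrix_mul_mul_apply, Matrix.inner_toEuclideanCLM,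
      EuclideanSpace.real_norm_sq_eq]
    simpa [dotProduct, sq] using hG (s 0)

end Filtering

/-- If `0 ⪯ G ⪯ c H`, then `G H⁻¹ G ⪯ c G`. -/
theorem dotProduct_inv_mulVec_le {n : ℕ} {G H : Matrix (Fin n) (Fin n) ℝ} (hH : H.PosDef)
    (hG : G.PosSemidef) {c : ℝ} (hc : 0 < c) (h : ∀ v, v ⬝ᵥ G *ᵥ v ≤ c * (v ⬝ᵥ H *ᵥ v))
    (v : Fin n → ℝ) : (G *ᵥ v) ⬝ᵥ H⁻¹ *ᵥ (G *ᵥ v) ≤ c * (v ⬝ᵥ G *ᵥ v) := by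
  have hu : IsUnit H.det := isUnit_iff_ne_zero.2 hH.det_pos.ne'
  have hGs : Gᵀ = G := by simpa using hG.1.eq
  set w := H⁻¹ *ᵥ (G *ᵥ v) with hw
  have hHw : H *ᵥ w = G *ᵥ v := by
    rw [hw, Matrix.mulVec_mulVec, Matrix.mul_nonsing_inv _ hu, Matrix.one_mulVec]
  have h1 : w ⬝ᵥ G *ᵥ w ≤ c * ((G *ᵥ v) ⬝ᵥ w) := by
    have := h w
    rwa [hHw, dotProduct_comm w (G *ᵥ v)] at this
  have h2 := hG.dotProduct_mulVec_nonneg (v - c⁻¹ • w)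
  have h3 : v ⬝ᵥ G *ᵥ w = (G *ᵥ v) ⬝ᵥ w := by
    rw [Matrix.dotProduct_mulVec, ← Matrix.mulVec_transpose, hGs]
  simp only [star_trivial, Matrix.mulVec_sub, Matrix.mulVec_smul, dotProduct_sub, sub_dotProduct,
    dotProduct_smul, smul_dotProduct, smul_eq_mul, h3, dotProduct_comm w (G *ᵥ v)] at h2
  have h4 : c * (c⁻¹ * (c⁻¹ * (w ⬝ᵥ G *ᵥ w))) ≤ (G *ᵥ v) ⬝ᵥ w := by
    rw [mul_inv_cancel_left₀ hc.ne', inv_mul_le_iff₀ hc]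
    exact h1
  have h5 : c * (c⁻¹ * ((G *ᵥ v) ⬝ᵥ w)) = (G *ᵥ v) ⬝ᵥ w := mul_inv_cancel_left₀ hc.ne' _
  have h6 := mul_le_mul_of_nonneg_left h2 hc.le
  nlinarith

/-! ### Convex functions near a nondegenerate minimizer -/

section Convex

open scoped InnerProductSpace

variable {E : Type*} [NormedAddCommGroup E] [InnerProductSpace ℝ E] [CompleteSpace E] {f : E → ℝ}

theorem hasDerivAt_line {E : Type*} [NormedAddCommGroup E] [NormedSpace ℝ E] (x v : E)
    (t : ℝ) : HasDerivAt (fun t : ℝ => x + t • v) v t := by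
  simpa using ((hasDerivAt_id t).smul_const v).const_add x

theorem hasDerivAt_comp_line (hf : Differentiable ℝ f) (x v : E) (t : ℝ) :
    HasDerivAt (fun t : ℝ => f (x + t • v)) ⟪gradient f (x + t • v), v⟫_ℝ t := by
  rw [inner_gradient_left]
  exact (hf _).hasFDerivAt.comp_hasDerivAt t (hasDerivAt_line x v t)

theorem hasDerivAt_inner_gradient_line (hf : Differentiable ℝ (gradient f)) (x v w : E) (t : ℝ) :
    HasDerivAt (fun t : ℝ => ⟪gradient f (x + t • v), w⟫_ℝ)
      ⟪fderiv ℝ (gradient f) (x + t • v) v, w⟫_ℝ t := by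
  have h := (hf (x + t • v)).hasFDerivAt.comp_hasDerivAt t (hasDerivAt_line x v t)
  simpa using h.inner ℝ (hasDerivAt_const t w)

/-- The mean value theorem for the gradient along a segment. -/
theorem exists_inner_gradient_sub_eq (hf : Differentiable ℝ (gradient f)) (x v : E) :
    ∃ t ∈ Set.Ioo (0 : ℝ) 1, ⟪gradient f (x + v) - gradient f x, v⟫_ℝ =
      ⟪v, fderiv ℝ (gradient f) (x + t • v) v⟫_ℝ := by
  have hd := hasDerivAt_inner_gradient_line hf x v v
  obtain ⟨t, ht, h⟩ := exists_hasDerivAt_eq_slope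
    (fun t : ℝ => ⟪gradient f (x + t • v), v⟫_ℝ) _ zero_lt_one
    (fun t _ => (hd t).continuousAt.continuousWithinAt) fun t _ => hd t
  refine ⟨t, ht, ?_⟩
  rw [real_inner_comm (fderiv ℝ (gradient f) (x + t • v) v) v, h]
  simp [inner_sub_left]

theorem add_inner_gradient_le (hconv : ConvexOn ℝ Set.univ f) (hf : Differentiable ℝ f) (x v : E) :
    f x + ⟪gradient f x, v⟫_ℝ ≤ f (x + v) := by
  have hc : ConvexOn ℝ Set.univ fun t : ℝ => f (x + t • v) := by
    have := hconv.comp_affineMap (AffineMap.lineMap x (x + v))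
    simpa [Function.comp_def, AffineMap.lineMap_apply, add_comm] using this
  have h := hc.le_slope_of_hasDerivAt (Set.mem_univ 0) (Set.mem_univ 1) zero_lt_one
    (hasDerivAt_comp_line hf x v 0)
  simp only [slope_def_field, zero_smul, add_zero, one_smul, sub_zero, div_one] at h
  linarith

theorem inner_gradient_sub_nonneg (hconv : ConvexOn ℝ Set.univ f) (hf : Differentiable ℝ f)
    (x y : E) : 0 ≤ ⟪gradient f y - gradient f x, y - x⟫_ℝ := by
  have h1 := add_inner_gradient_le hconv hf x (y - x)
  have h2 := add_inner_gradient_le hconv hf y (x - y)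
  rw [add_sub_cancel] at h1 h2
  rw [← neg_sub y x, inner_neg_right] at h2
  rw [inner_sub_left]
  linarith

theorem inner_fderiv_gradient_nonneg (hconv : ConvexOn ℝ Set.univ f) (hf : Differentiable ℝ f)
    (hf2 : Differentiable ℝ (gradient f)) (x v : E) :
    0 ≤ ⟪v, fderiv ℝ (gradient f) x v⟫_ℝ := by
  have hmono : Monotone fun t : ℝ => ⟪gradient f (x + t • v), v⟫_ℝ := by
    intro a b hab
    rcases hab.eq_or_lt with rfl | hab
    · exact le_rfl
    have h := inner_gradient_sub_nonneg hconv hf (x + a • v) (x + b • v)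
    rw [add_sub_add_left_eq_sub, ← sub_smul, real_inner_smul_right, inner_sub_left] at h
    have := nonneg_of_mul_nonneg_right h (sub_pos.2 hab)
    simpa using this
  have h := (hasDerivAt_inner_gradient_line hf2 x v v 0).deriv
  rw [zero_smul, add_zero, real_inner_comm] at h
  rw [← h]
  exact hmono.deriv_nonneg

variable {xs : E} {m r : ℝ}

theorem gradient_eq_zero_of_forall_le (hmin : ∀ x, f xs ≤ f x) : gradient f xs = 0 := by
  have : IsLocalMin f xs := Eventually.of_forall hmin
  rw [gradient, this.fderiv_eq_zero, map_zero]

/-- Strong convexity near the minimizer propagates along rays, as the gradient of a convex function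
is monotone. -/
theorem le_inner_gradient_ray (hconv : ConvexOn ℝ Set.univ f) (hf : Differentiable ℝ f)
    (hf2 : Differentiable ℝ (gradient f)) (hmin : ∀ x, f xs ≤ f x) (hr : 0 < r)
    (hm : 0 < m)
    (hG : ∀ x ∈ Metric.closedBall xs r, ∀ v, m * ‖v‖ ^ 2 ≤ ⟪v, fderiv ℝ (gradient f) x v⟫_ℝ)
    (e : E) : m * (min ‖e‖ r * ‖e‖) ≤ ⟪gradient f (xs + e), e⟫_ℝ := by
  have hg0 := gradient_eq_zero_of_forall_le hmin
  have near : ∀ e : E, ‖e‖ ≤ r → m * ‖e‖ ^ 2 ≤ ⟪gradient f (xs + e), e⟫_ℝ := by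
    intro e he
    obtain ⟨t, ht, h⟩ := exists_inner_gradient_sub_eq hf2 xs e
    rw [hg0, sub_zero] at h
    rw [h]
    refine hG _ ?_ e
    rw [mem_closedBall_iff_norm, add_sub_cancel_left, norm_smul, Real.norm_of_nonneg ht.1.le]
    nlinarith [norm_nonneg e, ht.2]
  rcases le_total ‖e‖ r with he | he
  · rw [min_eq_left he, ← sq]
    exact near e he
  · have hpos : 0 < ‖e‖ := hr.trans_le he
    rw [min_eq_right he]
    set θ := r / ‖e‖ with hθ
    have hθ0 : 0 < θ := div_pos hr hpos
    have hθ1 : θ ≤ 1 := (div_le_one hpos).2 he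
    have hn : ‖θ • e‖ = r := by
      rw [norm_smul, Real.norm_of_nonneg hθ0.le, hθ, div_mul_cancel₀ _ hpos.ne']
    have h1 := near (θ • e) hn.le
    rw [hn, real_inner_smul_right] at h1
    have h3 : m * (r * ‖e‖) ≤ ⟪gradient f (xs + θ • e), e⟫_ℝ := by
      have h4 : m * r ^ 2 = θ * (m * (r * ‖e‖)) := by
        rw [hθ]
        field_simp
      rw [h4] at h1
      exact le_of_mul_le_mul_left h1 hθ0
    have h2 := inner_gradient_sub_nonneg hconv hf (xs + θ • e) (xs + e)
    have h5 : xs + e - (xs + θ • e) = (1 - θ) • e := by rw [sub_smul, one_smul]; abel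
    rw [h5, real_inner_smul_right, inner_sub_left] at h2
    rcases hθ1.eq_or_lt with h6 | h6
    · rwa [h6, one_smul] at h3
    · have := nonneg_of_mul_nonneg_right h2 (sub_pos.2 h6)
      linarith

/-- On a level set, `f` behaves like a strongly convex function with respect to its minimizer. -/
theorem exists_level_set_bounds (hconv : ConvexOn ℝ Set.univ f) (hf : Differentiable ℝ f)
    (hf2 : Differentiable ℝ (gradient f)) (hmin : ∀ x, f xs ≤ f x) (hr : 0 < r)
    (hm : 0 < m)
    (hG : ∀ x ∈ Metric.closedBall xs r, ∀ v, m * ‖v‖ ^ 2 ≤ ⟪v, fderiv ℝ (gradient f) x v⟫_ℝ)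
    (F₀ : ℝ) : ∃ c > 0, ∀ x, f x ≤ F₀ → c * ‖x - xs‖ ^ 2 ≤ f x - f xs ∧
      c * ‖x - xs‖ ≤ ‖gradient f x‖ ∧ c * (f x - f xs) ≤ ‖gradient f x‖ ^ 2 := by
  set Δ := |F₀ - f xs| with hΔ
  obtain ⟨R, hR⟩ : ∃ R, R = 2 * r + 2 * Δ / (m * r) := ⟨_, rfl⟩
  have hmr : 0 < m * r := mul_pos hm hr
  have hR0 : 2 * r ≤ R := by
    have : 0 ≤ 2 * Δ / (m * r) := by positivity
    linarith
  have hRpos : 0 < R := by linarith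
  refine ⟨m * r / (2 * R), by positivity, fun x hx => ?_⟩
  obtain ⟨e, rfl⟩ : ∃ e, x = xs + e := ⟨x - xs, by abel⟩
  rw [add_sub_cancel_left]
  have h1 := le_inner_gradient_ray hconv hf hf2 hmin hr hm hG e
  have h2 : m * (min (‖e‖ / 2) r * (‖e‖ / 2)) ≤ f (xs + e) - f xs := by
    have h3 := le_inner_gradient_ray hconv hf hf2 hmin hr hm hG ((1 / 2 : ℝ) • e)
    have h4 := add_inner_gradient_le hconv hf (xs + (1 / 2 : ℝ) • e) ((1 / 2 : ℝ) • e)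
    rw [add_assoc, ← add_smul, add_halves, one_smul] at h4
    have h5 : ‖(1 / 2 : ℝ) • e‖ = ‖e‖ / 2 := by
      rw [norm_smul, Real.norm_of_nonneg (by norm_num)]
      ring
    rw [h5] at h3
    linarith [hmin (xs + (1 / 2 : ℝ) • e)]
  have hen := norm_nonneg e
  have heR : ‖e‖ ≤ R := by
    by_contra! hlt
    have h3 : min (‖e‖ / 2) r = r := min_eq_right (by linarith)
    rw [h3] at h2
    have h4 : f (xs + e) - f xs ≤ Δ := (sub_le_sub_right hx _).trans (le_abs_self _)
    have h5 : 2 * Δ / (m * r) < ‖e‖ := by linarith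
    rw [div_lt_iff₀ hmr] at h5
    nlinarith
  have hmin1 : r / R * ‖e‖ ≤ min (‖e‖ / 2) r := by
    rw [div_mul_eq_mul_div, div_le_iff₀ hRpos, min_mul_of_nonneg _ _ hRpos.le]
    refine le_min ?_ ?_ <;> nlinarith
  have hmin2 : r / R * ‖e‖ ≤ min ‖e‖ r :=
    hmin1.trans (min_le_min_right _ (by linarith))
  have hF : m * r / (2 * R) * ‖e‖ ^ 2 ≤ f (xs + e) - f xs := by
    calc m * r / (2 * R) * ‖e‖ ^ 2 = m * (r / R * ‖e‖ * (‖e‖ / 2)) := by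
          field_simp
      _ ≤ m * (min (‖e‖ / 2) r * (‖e‖ / 2)) := by gcongr
      _ ≤ _ := h2
  have hcs := real_inner_le_norm (gradient f (xs + e)) e
  have hg : m * r / (2 * R) * ‖e‖ ≤ ‖gradient f (xs + e)‖ := by
    rcases hen.eq_or_lt with h0 | h0
    · rw [← h0, mul_zero]
      exact norm_nonneg _
    · refine le_of_mul_le_mul_right ?_ h0
      calc m * r / (2 * R) * ‖e‖ * ‖e‖ ≤ m * (r / R * ‖e‖ * ‖e‖) := by
            have : m * (r / R * ‖e‖ * ‖e‖) = 2 * (m * r / (2 * R) * ‖e‖ * ‖e‖) := by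
              field_simp
            rw [this]
            have : 0 ≤ m * r / (2 * R) * ‖e‖ * ‖e‖ := by positivity
            linarith
        _ ≤ m * (min ‖e‖ r * ‖e‖) := by gcongr
        _ ≤ _ := h1.trans hcs
  refine ⟨hF, hg, ?_⟩
  have h3 : f (xs + e) - f xs ≤ ‖gradient f (xs + e)‖ * ‖e‖ := by
    have h4 := add_inner_gradient_le hconv hf (xs + e) (-e)
    rw [add_neg_cancel_right, inner_neg_right] at h4
    linarith
  calc m * r / (2 * R) * (f (xs + e) - f xs)
      ≤ m * r / (2 * R) * (‖gradient f (xs + e)‖ * ‖e‖) := by gcongr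
    _ = ‖gradient f (xs + e)‖ * (m * r / (2 * R) * ‖e‖) := by ring
    _ ≤ ‖gradient f (xs + e)‖ * ‖gradient f (xs + e)‖ := by gcongr
    _ = _ := by ring

theorem eventually_norm_gradient_sub_le (hf2 : Differentiable ℝ (gradient f))
    (hmin : ∀ x, f xs ≤ f x) {ω : ℝ} (hω : 0 < ω) : ∃ ρ > 0, ∀ e : E, ‖e‖ < ρ →
      ‖gradient f (xs + e) - fderiv ℝ (gradient f) xs e‖ ≤ ω * ‖e‖ := by
  have h := (hasFDerivAt_iff_isLittleO_nhds_zero.1 (hf2 xs).hasFDerivAt).def hω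
  obtain ⟨ρ, hρ, h⟩ := Metric.eventually_nhds_iff.1 h
  refine ⟨ρ, hρ, fun e he => ?_⟩
  have := h (y := e) (by simpa using he)
  rwa [gradient_eq_zero_of_forall_le hmin, sub_zero] at this

theorem abs_sub_quadratic_le (hf : Differentiable ℝ f)
    {ω ρ : ℝ} {T : E →L[ℝ] E}
    (h : ∀ e : E, ‖e‖ < ρ → ‖gradient f (xs + e) - T e‖ ≤ ω * ‖e‖) (hω : 0 ≤ ω) {e : E}
    (he : ‖e‖ < ρ) : |f (xs + e) - f xs - ⟪T e, e⟫_ℝ / 2| ≤ ω * ‖e‖ ^ 2 := by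
  have hd : ∀ t : ℝ, HasDerivAt (fun t : ℝ => f (xs + t • e) - t ^ 2 * (⟪T e, e⟫_ℝ / 2))
      (⟪gradient f (xs + t • e) - T (t • e), e⟫_ℝ) t := by
    intro t
    have h1 := (hasDerivAt_comp_line hf xs e t).sub
      (((hasDerivAt_id t).pow 2).mul_const (⟪T e, e⟫_ℝ / 2))
    refine h1.congr_deriv ?_
    rw [inner_sub_left, map_smul, real_inner_smul_left]
    norm_num
    ring
  obtain ⟨t, ht, h2⟩ := exists_hasDerivAt_eq_slope _ _ zero_lt_one
    (fun t _ => (hd t).continuousAt.continuousWithinAt) fun t _ => hd t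
  have h3 : f (xs + e) - f xs - ⟪T e, e⟫_ℝ / 2 = ⟪gradient f (xs + t • e) - T (t • e), e⟫_ℝ := by
    rw [h2]
    norm_num
    ring
  have hle : ‖t • e‖ ≤ ‖e‖ := by
    rw [norm_smul, Real.norm_of_nonneg ht.1.le]
    nlinarith [norm_nonneg e, ht.2]
  rw [h3]
  calc _ ≤ ‖gradient f (xs + t • e) - T (t • e)‖ * ‖e‖ := abs_real_inner_le_norm _ _
    _ ≤ ω * ‖t • e‖ * ‖e‖ := by
        gcongr
        exact h _ (hle.trans_lt he)
    _ ≤ ω * ‖e‖ * ‖e‖ := by gcongr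
    _ = _ := by ring

end Convex

/-! ### Single steps -/

section Steps

open scoped InnerProductSpace

variable {n : ℕ} {f : Vec n → ℝ} {F₀ M c : ℝ} {xs : Vec n}

theorem toEuclideanCLM_hessian (f : Vec n → ℝ) (x : Vec n) :
    Matrix.toEuclideanCLM (n := Fin n) (𝕜 := ℝ) (hessian f x) = fderiv ℝ (gradient f) x := by
  simp [hessian]

theorem dotProduct_hessian_mulVec (f : Vec n → ℝ) (x v w : Vec n) :
    v ⬝ᵥ hessian f x *ᵥ w = ⟪v, fderiv ℝ (gradient f) x w⟫_ℝ := by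
  rw [← toEuclideanCLM_hessian, Matrix.inner_toEuclideanCLM]

theorem norm_sq_eq_dotProduct (v : Vec n) : ‖v‖ ^ 2 = v ⬝ᵥ v := by
  rw [EuclideanSpace.real_norm_sq_eq]
  simp [dotProduct, sq]

theorem dotProduct_smul_sub_mulVec {A : Matrix (Fin n) (Fin n) ℝ} (t : ℝ) (v : Fin n → ℝ) :
    v ⬝ᵥ (t • (1 : Matrix (Fin n) (Fin n) ℝ) - A) *ᵥ v = t * (v ⬝ᵥ v) - v ⬝ᵥ A *ᵥ v := by
  rw [Matrix.sub_mulVec, Matrix.smul_mulVec, Matrix.one_mulVec, dotProduct_sub, dotProduct_smul,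
    smul_eq_mul]

/-- The consequences of the assumptions on `f` that are used on the level set `{f ≤ F₀}`: the
Hessian lies between `0` and `M`, and `f` grows like a strongly convex function with respect to its
minimizer `xs`. -/
structure LevelSetBounds (f : Vec n → ℝ) (F₀ : ℝ) (xs : Vec n) (M c : ℝ) : Prop where
  convexOn : ConvexOn ℝ Set.univ f
  differentiable : Differentiable ℝ f
  differentiable_gradient : Differentiable ℝ (gradient f)
  minimizer : ∀ x, f xs ≤ f x
  M_pos : 0 < M
  c_pos : 0 < c
  posSemidef : ∀ x, f x ≤ F₀ → (hessian f x).PosSemidef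
  hessian_le : ∀ x, f x ≤ F₀ → ∀ v : Fin n → ℝ, v ⬝ᵥ hessian f x *ᵥ v ≤ M * (v ⬝ᵥ v)
  growth : ∀ x, f x ≤ F₀ → c * ‖x - xs‖ ^ 2 ≤ f x - f xs
  norm_gradient : ∀ x, f x ≤ F₀ → c * ‖x - xs‖ ≤ ‖gradient f x‖
  gradient_dominated : ∀ x, f x ≤ F₀ → c * (f x - f xs) ≤ ‖gradient f x‖ ^ 2

theorem LevelSetBounds.gradient_ne_zero (h : LevelSetBounds f F₀ xs M c) {x : Vec n}
    (hx : f x ≤ F₀) (hne : x ≠ xs) : gradient f x ≠ 0 := by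
  intro h0
  have h1 := h.norm_gradient x hx
  rw [h0, norm_zero] at h1
  have h2 := mul_pos h.c_pos (norm_pos_iff.2 (sub_ne_zero.2 hne))
  linarith

theorem mulVec_direction {B : Matrix (Fin n) (Fin n) ℝ} (hB : B.PosDef) (x : Vec n) :
    B *ᵥ (direction f B x).ofLp = -(gradient f x).ofLp := by
  rw [direction, WithLp.ofLp_neg, Matrix.ofLp_toEuclideanCLM, Matrix.mulVec_neg,
    Matrix.mulVec_mulVec, Matrix.mul_nonsing_inv _ (isUnit_iff_ne_zero.2 hB.det_pos.ne'),
    Matrix.one_mulVec]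

theorem inner_gradient_direction_neg {B : Matrix (Fin n) (Fin n) ℝ} (hB : B.PosDef) {x : Vec n}
    (hx : gradient f x ≠ 0) : ⟪gradient f x, direction f B x⟫_ℝ < 0 := by
  rw [direction, inner_neg_right, Matrix.inner_toEuclideanCLM, neg_lt_zero]
  have : (gradient f x).ofLp ≠ 0 := by simpa using hx
  simpa using hB.inv.dotProduct_mulVec_pos this

theorem direction_eq_zero (B : Matrix (Fin n) (Fin n) ℝ) {x : Vec n} (hx : gradient f x = 0) :
    direction f B x = 0 := by
  rw [direction, hx, map_zero, neg_zero]

/-- One quasi-Newton step reduces the error in `f` by a factor governed by the angle between the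
step and the gradient. -/
theorem LevelSetBounds.step (h : LevelSetBounds f F₀ xs M c) {α β : ℝ} (hα : 0 < α)
    (hα1 : α < 1) (hβ : β < 1) {B : Matrix (Fin n) (Fin n) ℝ} (hB : B.PosDef) {x : Vec n}
    (hx : f x ≤ F₀) (hne : gradient f x ≠ 0) {lam : ℝ}
    (hls : IsLineSearchStep f α β x (direction f B x) lam) :
    0 < lam ∧ lam • direction f B x ≠ 0 ∧ f (x + lam • direction f B x) ≤ f x ∧
      f (x + lam • direction f B x) - f xs ≤
        f x - f xs - α * (1 - β) / M * c * cosSq B (lam • direction f B x).ofLp * (f x - f xs) := by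
  set d := direction f B x with hd
  obtain ⟨⟨harm, hwolfe⟩, -⟩ := hls
  have hp := inner_gradient_direction_neg hB hne
  rw [← hd] at hp
  set p := -⟪gradient f x, d⟫_ℝ with hpdef
  have hgd : ⟪gradient f x, d⟫_ℝ = -p := by rw [hpdef, neg_neg]
  have hp0 : 0 < p := by linarith
  rw [hgd] at harm hwolfe
  -- convexity rules out negative step sizes, and the Wolfe condition rules out `0`
  have hlam0 : 0 ≤ lam := by
    have h1 := add_inner_gradient_le h.convexOn h.differentiable x (lam • d)
    rw [real_inner_smul_right, hgd] at h1
    by_contra! hneg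
    nlinarith [mul_pos (neg_pos.2 hneg) hp0]
  have hlam : 0 < lam := by
    refine lt_of_le_of_ne hlam0 fun h0 => ?_
    rw [← h0, zero_smul, add_zero, hgd] at hwolfe
    nlinarith
  have hd0 : d ≠ 0 := by
    intro h0
    rw [h0, inner_zero_right] at hp
    exact lt_irrefl _ hp
  have hle : f (x + lam • d) ≤ f x := by
    have := mul_pos (mul_pos hα hlam) hp0
    linarith
  refine ⟨hlam, smul_ne_zero hlam.ne' hd0, hle, ?_⟩
  have hdpos : 0 < ‖d‖ ^ 2 := pow_pos (norm_pos_iff.2 hd0) 2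
  have hgpos : 0 < ‖gradient f x‖ ^ 2 := pow_pos (norm_pos_iff.2 hne) 2
  -- the Wolfe condition bounds the step size from below
  have hcurv : (1 - β) * p ≤ M * (lam * ‖d‖ ^ 2) := by
    obtain ⟨t, ht, h1⟩ := exists_inner_gradient_sub_eq h.differentiable_gradient x (lam • d)
    have hxt : f (x + t • lam • d) ≤ F₀ := by
      have h2 := h.convexOn.2 (Set.mem_univ x) (Set.mem_univ (x + lam • d))
        (sub_nonneg.2 ht.2.le) ht.1.le (by ring)
      have e : (1 - t) • x + t • (x + lam • d) = x + t • lam • d := by module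
      rw [e, smul_eq_mul, smul_eq_mul] at h2
      nlinarith [ht.1, ht.2]
    have h2 := h.hessian_le _ hxt (lam • d).ofLp
    rw [dotProduct_hessian_mulVec, ← h1, ← norm_sq_eq_dotProduct, norm_smul, mul_pow,
      Real.norm_of_nonneg hlam0, real_inner_smul_right, inner_sub_left, hgd] at h2
    have h3 : lam * ((1 - β) * p) ≤ lam * (M * (lam * ‖d‖ ^ 2)) := by nlinarith
    exact le_of_mul_le_mul_left h3 hlam
  have hcos : cosSq B (lam • d).ofLp = p ^ 2 / (‖d‖ ^ 2 * ‖gradient f x‖ ^ 2) := by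
    have hBd := mulVec_direction (f := f) hB x
    rw [← hd] at hBd
    have e1 : d.ofLp ⬝ᵥ (gradient f x).ofLp = -p := by
      rw [← hgd, EuclideanSpace.inner_eq_star_dotProduct]
      simp
    rw [cosSq, WithLp.ofLp_smul, Matrix.mulVec_smul, hBd]
    simp only [smul_dotProduct, dotProduct_smul, dotProduct_neg, neg_dotProduct, smul_eq_mul,
      ← norm_sq_eq_dotProduct, e1]
    field_simp
  rw [hcos]
  have hdom := h.gradient_dominated x hx
  have hM := h.M_pos
  have hdec : α * (1 - β) / M * (p ^ 2 / ‖d‖ ^ 2) ≤ α * lam * p := by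
    rw [div_mul_div_comm, div_le_iff₀ (mul_pos hM hdpos)]
    nlinarith [mul_le_mul_of_nonneg_left hcurv (mul_pos hα hp0).le]
  have hfac : 0 ≤ α * (1 - β) / M * (p ^ 2 / ‖d‖ ^ 2) := by
    have := sub_pos.2 hβ
    positivity
  calc f (x + lam • d) - f xs ≤ f x - f xs - α * lam * p := by linarith
    _ ≤ f x - f xs - α * (1 - β) / M * (p ^ 2 / ‖d‖ ^ 2) * 1 := by linarith
    _ ≤ f x - f xs - α * (1 - β) / M * (p ^ 2 / ‖d‖ ^ 2) *
        (c * (f x - f xs) / ‖gradient f x‖ ^ 2) := by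
        have : c * (f x - f xs) / ‖gradient f x‖ ^ 2 ≤ 1 := (div_le_one hgpos).2 hdom
        have := mul_le_mul_of_nonneg_left this hfac
        linarith
    _ = _ := by
        field_simp

/-- If `x + d` is much closer to the minimizer than `x`, then the step size `1` satisfies the
Armijo-Wolfe conditions: `f` drops by about `⟪T e, e⟫ / 2`, while `⟪gradient f x, d⟫` is about
`-⟪T e, e⟫`, and `α < 1 / 2`. -/
theorem armijoWolfe_one_of_close (hf : Differentiable ℝ f) {T : Vec n →L[ℝ] Vec n} {m Λ κ ω ρ : ℝ}
    (hG : ∀ v, m * ‖v‖ ^ 2 ≤ ⟪v, T v⟫_ℝ) (hΛ0 : 0 ≤ Λ) (hΛ : ∀ v, ‖T v‖ ≤ Λ * ‖v‖) {α β : ℝ}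
    (hα : 0 < α) (hα2 : α < 1 / 2) (hβ0 : 0 < β) (hβ : β < 1) (hκ0 : 0 < κ) (hκ1 : κ ≤ 1)
    (hκA : (3 * Λ + 4) * κ ≤ (1 / 2 - α) * m) (hκW : (3 * Λ + 4) * κ ≤ β * m)
    (hω0 : 0 < ω) (hωκ : ω ≤ κ)
    (hgrad : ∀ e : Vec n, ‖e‖ < ρ → ‖gradient f (xs + e) - T e‖ ≤ ω * ‖e‖) {e d : Vec n}
    (hx : ‖e‖ < ρ) (hclose : ‖e + d‖ ≤ κ * ‖e‖) : ArmijoWolfe f α β (xs + e) d 1 := by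
  obtain ⟨e', he'⟩ : ∃ e', e' = e + d := ⟨_, rfl⟩
  have hde : d = e' - e := by rw [he']; abel
  have hxd : xs + e + d = xs + e' := by rw [he', add_assoc]
  rw [← he'] at hclose
  have hen := norm_nonneg e
  have hen' := norm_nonneg e'
  have hdn : ‖d‖ ≤ ‖e'‖ + ‖e‖ := by
    rw [hde]
    exact norm_sub_le _ _
  have hee : ‖e'‖ ≤ ‖e‖ := hclose.trans (mul_le_of_le_one_left hen hκ1)
  have hd2 : ‖d‖ ≤ 2 * ‖e‖ := by linarith
  have hge := hgrad e hx
  have hge' := hgrad e' (hee.trans_lt hx)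
  have hq := (abs_le.1 (abs_sub_quadratic_le hf hgrad hω0.le hx)).1
  have hq' := (abs_le.1 (abs_sub_quadratic_le hf hgrad hω0.le (hee.trans_lt hx))).2
  obtain ⟨N, hN⟩ : ∃ N, N = ‖e‖ ^ 2 := ⟨_, rfl⟩
  have hN0 : 0 ≤ N := hN ▸ sq_nonneg _
  obtain ⟨Q, hQ⟩ : ∃ Q, Q = ⟪T e, e⟫_ℝ := ⟨_, rfl⟩
  obtain ⟨p, hp⟩ : ∃ p, p = ⟪gradient f (xs + e), d⟫_ℝ := ⟨_, rfl⟩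
  -- the directional derivative is close to `-⟪T e, e⟫`
  have hgd : |p + Q| ≤ (Λ + 2) * κ * N := by
    have h1 : p + Q = ⟪gradient f (xs + e) - T e, d⟫_ℝ + ⟪T e, e'⟫_ℝ := by
      rw [hp, hQ, inner_sub_left, hde]
      simp only [inner_sub_right]
      ring
    rw [h1]
    have h2 := abs_real_inner_le_norm (gradient f (xs + e) - T e) d
    have h3 := abs_real_inner_le_norm (T e) e'
    have h4 : ‖gradient f (xs + e) - T e‖ * ‖d‖ ≤ κ * ‖e‖ * (2 * ‖e‖) := by
      gcongr
      exact hge.trans (by gcongr)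
    have h5 : ‖T e‖ * ‖e'‖ ≤ Λ * ‖e‖ * (κ * ‖e‖) := by
      gcongr
      exact hΛ e
    refine (abs_add_le _ _).trans ?_
    have h6 : (Λ + 2) * κ * N = Λ * ‖e‖ * (κ * ‖e‖) + κ * ‖e‖ * (2 * ‖e‖) := by rw [hN]; ring
    linarith
  have hgd1 := (abs_le.1 hgd).1
  have hgd2 := (abs_le.1 hgd).2
  have hQm : m * N ≤ Q := by
    rw [hQ, hN, real_inner_comm]
    exact hG e
  have hQ' : ⟪T e', e'⟫_ℝ ≤ Λ * κ * N := by
    refine (real_inner_le_norm _ _).trans ?_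
    calc ‖T e'‖ * ‖e'‖ ≤ Λ * ‖e'‖ * ‖e'‖ := by
          gcongr
          exact hΛ e'
      _ ≤ Λ * (κ * ‖e‖) * ‖e‖ := by gcongr
      _ = _ := by rw [hN]; ring
  have he2 : ω * ‖e‖ ^ 2 ≤ κ * N := by rw [hN]; gcongr
  have he2' : ω * ‖e'‖ ^ 2 ≤ κ * N := by rw [hN]; gcongr
  have hA := mul_le_mul_of_nonneg_right hκA hN0
  have hW := mul_le_mul_of_nonneg_right hκW hN0
  have hκN : 0 ≤ κ * N := by positivity
  have hΛκN : 0 ≤ Λ * (κ * N) := by positivity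
  have hX0 : 0 ≤ (Λ + 2) * κ * N := by positivity
  refine ⟨?_, ?_⟩
  · rw [one_smul, hxd, mul_one, ← hp]
    rw [← hQ] at hq
    have h1 := mul_le_mul_of_nonneg_left hgd1 hα.le
    have h2 : α * ((Λ + 2) * κ * N) ≤ (Λ + 2) * κ * N :=
      mul_le_of_le_one_left hX0 (by linarith)
    have h3 := mul_le_mul_of_nonneg_left hQm (sub_pos.2 hα2).le
    linarith
  · rw [one_smul, hxd, ← hp]
    have h1 : -(2 * (Λ + 1) * κ * N) ≤ ⟪gradient f (xs + e'), d⟫_ℝ := by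
      have h2 := (abs_le.1 (abs_real_inner_le_norm (gradient f (xs + e')) d)).1
      have h3 : ‖gradient f (xs + e')‖ ≤ (Λ + 1) * (κ * ‖e‖) := by
        have e1 : gradient f (xs + e') = (gradient f (xs + e') - T e') + T e' := by abel
        rw [e1]
        refine (norm_add_le _ _).trans ((add_le_add hge' (hΛ e')).trans ?_)
        have h4 : ω * ‖e'‖ ≤ 1 * (κ * ‖e‖) := by
          gcongr
          exact hωκ.trans hκ1
        have h5 : Λ * ‖e'‖ ≤ Λ * (κ * ‖e‖) := by gcongr
        linarith
      have h6 : ‖gradient f (xs + e')‖ * ‖d‖ ≤ (Λ + 1) * (κ * ‖e‖) * (2 * ‖e‖) := by gcongr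
      have h7 : (Λ + 1) * (κ * ‖e‖) * (2 * ‖e‖) = 2 * (Λ + 1) * κ * N := by rw [hN]; ring
      linarith
    have h2 := mul_le_mul_of_nonneg_left hgd2 hβ0.le
    have h3 : β * ((Λ + 2) * κ * N) ≤ (Λ + 2) * κ * N := mul_le_of_le_one_left hX0 hβ.le
    have h4 := mul_le_mul_of_nonneg_left hQm hβ0.le
    linarith

/-- Near the minimizer, a direction that nearly solves the Newton equation is nearly the Newton
step; the step size `1` then satisfies the Armijo-Wolfe conditions and almost reaches the
minimizer. -/
theorem exists_unit_step (hf : Differentiable ℝ f) (hf2 : Differentiable ℝ (gradient f))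
    (hmin : ∀ x, f xs ≤ f x) {m : ℝ} (hm : 0 < m)
    (hG : ∀ v, m * ‖v‖ ^ 2 ≤ ⟪v, fderiv ℝ (gradient f) xs v⟫_ℝ) {α β : ℝ} (hα : 0 < α)
    (hα2 : α < 1 / 2) (hβ0 : 0 < β) (hβ : β < 1) {ε : ℝ} (hε : 0 < ε) :
    ∃ η > 0, ∃ ρ > 0, ∀ x d : Vec n, ‖x - xs‖ < ρ →
      ‖gradient f x + fderiv ℝ (gradient f) xs d‖ ≤ η * ‖d‖ →
      ‖x + d - xs‖ ≤ ε * ‖x - xs‖ ∧ ArmijoWolfe f α β x d 1 := by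
  set T := fderiv ℝ (gradient f) xs with hT
  obtain ⟨Λ, hΛ⟩ : ∃ Λ, Λ = ‖T‖ := ⟨_, rfl⟩
  have hΛ0 : 0 ≤ Λ := hΛ ▸ norm_nonneg T
  have hTle : ∀ v, ‖T v‖ ≤ Λ * ‖v‖ := fun v => hΛ ▸ T.le_opNorm v
  obtain ⟨κ, hκ0, hκ1, hκε, hκA, hκW⟩ : ∃ κ > 0, κ ≤ 1 ∧ κ ≤ ε ∧
      (3 * Λ + 4) * κ ≤ (1 / 2 - α) * m ∧ (3 * Λ + 4) * κ ≤ β * m := by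
    have hΛ4 : 0 < 3 * Λ + 4 := by positivity
    have h1 : 0 < (1 / 2 - α) * m / (3 * Λ + 4) := by
      have := sub_pos.2 hα2
      positivity
    have h2 : 0 < β * m / (3 * Λ + 4) := by positivity
    refine ⟨min (min 1 ε) (min ((1 / 2 - α) * m / (3 * Λ + 4)) (β * m / (3 * Λ + 4))),
      lt_min (lt_min one_pos hε) (lt_min h1 h2), (min_le_left _ _).trans (min_le_left _ _),
      (min_le_left _ _).trans (min_le_right _ _), ?_, ?_⟩
    · rw [← le_div_iff₀' hΛ4]
      exact (min_le_right _ _).trans (min_le_left _ _)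
    · rw [← le_div_iff₀' hΛ4]
      exact (min_le_right _ _).trans (min_le_right _ _)
  obtain ⟨ω, hω0, hωκ, hωm⟩ : ∃ ω > 0, ω ≤ κ ∧ 4 * ω ≤ m * κ := by
    refine ⟨min κ (m * κ / 4), by positivity, min_le_left _ _, ?_⟩
    linarith [min_le_right κ (m * κ / 4)]
  obtain ⟨ρ, hρ, hgrad⟩ := eventually_norm_gradient_sub_le hf2 hmin hω0
  refine ⟨ω, hω0, ρ, hρ, fun x d hx hd => ?_⟩
  obtain ⟨e, rfl⟩ : ∃ e, x = xs + e := ⟨x - xs, by abel⟩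
  have hxd : xs + e + d - xs = e + d := by abel
  rw [hxd]
  rw [add_sub_cancel_left] at hx ⊢
  have hge := hgrad e hx
  have hen := norm_nonneg e
  have hmT : ∀ v, m * ‖v‖ ≤ ‖T v‖ := by
    intro v
    rcases (norm_nonneg v).eq_or_lt with h0 | h0
    · rw [← h0, mul_zero]
      exact norm_nonneg _
    · refine le_of_mul_le_mul_right ?_ h0
      have := real_inner_le_norm v (T v)
      nlinarith [hG v]
  have hdn : ‖d‖ ≤ ‖e + d‖ + ‖e‖ := by
    have : d = (e + d) - e := by abel
    conv_lhs => rw [this]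
    exact norm_sub_le _ _
  have hclose : ‖e + d‖ ≤ κ * ‖e‖ := by
    have h1 : T (e + d) = (gradient f (xs + e) + T d) - (gradient f (xs + e) - T e) := by
      rw [map_add]
      abel
    have h2 : m * ‖e + d‖ ≤ ω * ‖d‖ + ω * ‖e‖ := by
      refine (hmT (e + d)).trans ?_
      rw [h1]
      exact (norm_sub_le _ _).trans (add_le_add hd hge)
    have h3 : ω * ‖d‖ ≤ ω * (‖e + d‖ + ‖e‖) := by gcongr
    have h4 : 4 * ω ≤ m := hωm.trans (mul_le_of_le_one_right hm.le hκ1)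
    have h5 : m * ‖e + d‖ ≤ m * (κ * ‖e‖) := by
      have h6 := mul_le_mul_of_nonneg_right hωm hen
      have h7 := mul_le_mul_of_nonneg_right h4 (norm_nonneg (e + d))
      have h8 := mul_nonneg hm.le (norm_nonneg (e + d))
      linarith
    exact le_of_mul_le_mul_left h5 hm
  exact ⟨hclose.trans (by gcongr), armijoWolfe_one_of_close hf hG hΛ0 hTle hα hα2 hβ0 hβ hκ0 hκ1
    hκA hκW hω0 hωκ hgrad hx hclose⟩

end Steps

/-! ### Convergence -/

section Potential

variable {n : ℕ} {ι : Type} [Fintype ι] [DecidableEq ι]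

theorem potential_blockUpdate_le {B G H : Matrix (Fin n) (Fin n) ℝ}
    {D : Matrix (Fin n) ι ℝ} (hB : B.PosDef) (hH : H.PosDef) (hG : Gᵀ = G)
    (hD : Function.Injective D.mulVec) {c γ : ℝ} (hγ : 0 < γ)
    (hc : ∀ v, (G *ᵥ v) ⬝ᵥ H⁻¹ *ᵥ (G *ᵥ v) ≤ c * (v ⬝ᵥ G *ᵥ v))
    (hGD : ∀ y, γ * ((D *ᵥ y) ⬝ᵥ H *ᵥ (D *ᵥ y)) ≤ (D *ᵥ y) ⬝ᵥ G *ᵥ (D *ᵥ y)) :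
    potential H (blockUpdate B G D) ≤
      potential H B + Fintype.card ι * (c - 1 - Real.log γ) := by
  obtain ⟨R, l, -, hEH, hEB, hl, hpot⟩ := exists_basis_potential_blockUpdate_le hB hH hG hD hγ
    hc hGD
  have h1 : (Fintype.card ι : ℝ) ≤
      ∑ j, (((D * R)ᵀ * (B * H⁻¹ * B) * (D * R)) j j / l j - Real.log (l j)) := by
    calc (Fintype.card ι : ℝ) = ∑ _j : ι, (1 : ℝ) := by simp
      _ ≤ _ := Finset.sum_le_sum fun j _ =>
        one_le_sub_log (hl j) (diagonal_le_of_orthonormal hB hH hEH hEB hl j)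
  linarith

theorem cosSq_nonneg (B : Matrix (Fin n) (Fin n) ℝ) (s : Fin n → ℝ) : 0 ≤ cosSq B s := by
  refine div_nonneg (sq_nonneg _) (mul_nonneg ?_ ?_) <;>
    exact Finset.sum_nonneg fun _ _ => mul_self_nonneg _

/-- A bound on the potential bounds all angles between `s` and `B s`: otherwise a single update
along `s` would push the potential below its minimum. -/
theorem exp_neg_potential_le_cosSq {B : Matrix (Fin n) (Fin n) ℝ} (hB : B.PosDef) {s : Vec n}
    (hs : s ≠ 0) : Real.exp (-2 * (potential 1 B + 1)) ≤ 2 * cosSq B s.ofLp := by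
  set D : Matrix (Fin n) Unit ℝ := colMatrix fun _ => s with hD
  have hmul : ∀ y : Unit → ℝ, D *ᵥ y = (y () • s).ofLp := by
    intro y
    rw [hD, colMatrix_mulVec]
    simp
  have hinj : Function.Injective D.mulVec := by
    intro y z hyz
    rw [hmul, hmul] at hyz
    have h1 := WithLp.ofLp_injective 2 hyz
    funext u
    exact smul_left_injective ℝ hs h1
  have hpd : (blockUpdate B 1 D).PosDef := posDef_blockUpdate hB
    (posDef_transpose_mul_mul hB hinj) Matrix.transpose_one
    (posDef_transpose_mul_mul Matrix.PosDef.one hinj)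
  have h := exp_potential_blockUpdate_le (c := 1) (γ := 1) hB Matrix.transpose_one hinj one_pos
    (by simp) (by simp) (y := fun _ => 1) (fun h => one_ne_zero (congrFun h ()))
  have h0 := le_potential Matrix.PosDef.one hpd
  rw [Matrix.det_one, Real.log_one, sub_zero] at h0
  have hn : (0 : ℝ) ≤ n := Nat.cast_nonneg n
  rw [hmul, one_smul] at h
  simp only [Fintype.card_unit, Nat.cast_one, Real.log_one, sub_zero, mul_one] at h
  refine le_trans (Real.exp_le_exp.2 ?_) h
  linarith

end Potential

section Run

open scoped InnerProductSpace

variable {n q : ℕ} {f : Vec n → ℝ} {F₀ M c α β τ : ℝ} {x₁ xs : Vec n}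
  {B₁ : Matrix (Fin n) (Fin n) ℝ} {x : ℕ → Fin (q + 1) → Vec n}
  {B : ℕ → Matrix (Fin n) (Fin n) ℝ} {lam : ℕ → Fin q → ℝ}

/-- The matrix `D` of the retained steps of a block. -/
noncomputable def keptMatrix (f : Vec n → ℝ) (τ : ℝ) (B : Matrix (Fin n) (Fin n) ℝ)
    (x : Fin (q + 1) → Vec n) (lam : Fin q → ℝ) : Matrix (Fin n) (keptSteps f τ B x lam) ℝ :=
  colMatrix fun i : keptSteps f τ B x lam => blockSteps f B x lam i

theorem keptMatrix_mulVec_single (B : Matrix (Fin n) (Fin n) ℝ) (y : Fin (q + 1) → Vec n)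
    (l : Fin q → ℝ) (i : keptSteps f τ B y l) :
    keptMatrix f τ B y l *ᵥ Pi.single i 1 = (blockSteps f B y l i).ofLp := by
  funext r
  simp [keptMatrix, colMatrix]

theorem keptMatrix_spec {B : Matrix (Fin n) (Fin n) ℝ} {y : Fin (q + 1) → Vec n}
    {l : Fin q → ℝ} (hG : (hessian f (y (Fin.last q))).PosSemidef) (hτ : 0 < τ) (hM0 : 0 ≤ M)
    (hM : ∀ v : Fin n → ℝ, v ⬝ᵥ hessian f (y (Fin.last q)) *ᵥ v ≤ M * (v ⬝ᵥ v))
    (hs : ∀ i, blockSteps f B y l i ≠ 0) :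
    Function.Injective (keptMatrix f τ B y l).mulVec ∧
      ∀ v, (filterConst τ M q)⁻¹ * ((keptMatrix f τ B y l *ᵥ v) ⬝ᵥ (keptMatrix f τ B y l *ᵥ v)) ≤
        (keptMatrix f τ B y l *ᵥ v) ⬝ᵥ
          hessian f (y (Fin.last q)) *ᵥ (keptMatrix f τ B y l *ᵥ v) :=
  filterSteps_spec hG hτ hM0 hM hs

/-- If the starting point of a step is stationary, the step is zero. -/
theorem IsRun.succ_eq_of_gradient_eq_zero (hrun : IsRun f α β τ x₁ B₁ x B lam) {k : ℕ} {i : Fin q}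
    (h : gradient f (x k i.castSucc) = 0) : x k i.succ = x k i.castSucc := by
  rw [hrun.step k i, blockSteps, direction_eq_zero _ h, smul_zero, add_zero]

/-- A run that reaches a stationary point stays there in all later blocks. -/
theorem IsRun.eq_of_eq (hrun : IsRun f α β τ x₁ B₁ x B lam) (h0 : gradient f xs = 0) {k : ℕ}
    {j : Fin (q + 1)} (hk : x k j = xs) {k' : ℕ} (hk' : k < k') (j' : Fin (q + 1)) :
    x k' j' = xs := by
  have hstep : ∀ k (i : Fin q), x k i.castSucc = xs → x k i.succ = xs := by
    intro k i hi
    rw [hrun.succ_eq_of_gradient_eq_zero (by rw [hi, h0]), hi]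
  have hblock : ∀ k, x k 0 = xs → ∀ j, x k j = xs := fun k hk0 j =>
    Fin.induction hk0 (fun i hi => hstep k i hi) j
  have hlast : x k (Fin.last q) = xs := by
    have : ∀ i : Fin (q + 1), j ≤ i → x k i = xs := by
      intro i
      induction i using Fin.induction with
      | zero =>
        intro h
        rw [← hk, Fin.le_zero_iff.1 h]
      | succ i ih =>
        intro h
        rcases h.eq_or_lt with h | h
        · rw [← h, hk]
        · exact hstep k i (ih (Fin.le_castSucc_iff.2 h))
    exact this _ (Fin.le_last j)
  induction k', hk' using Nat.le_induction generalizing j' with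
  | base => exact hblock _ (by rw [hrun.next_block, hlast]) j'
  | succ k' _ ih => exact hblock _ (by rw [hrun.next_block, ih]) j'

/-- A run of Block BFGS that never reaches the minimizer, together with the bounds on `f` that
govern it. -/
structure NonterminatingRun (f : Vec n → ℝ) (α β τ : ℝ) (x₁ xs : Vec n) (M c : ℝ)
    (x : ℕ → Fin (q + 1) → Vec n) (B : ℕ → Matrix (Fin n) (Fin n) ℝ) (lam : ℕ → Fin q → ℝ) :
    Prop where
  bounds : LevelSetBounds f (f x₁) xs M c
  run : IsRun f α β τ x₁ (B 0) x B lam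
  posDef_zero : (B 0).PosDef
  α_pos : 0 < α
  α_lt : α < 1
  β_lt : β < 1
  τ_pos : 0 < τ
  ne : ∀ k j, x k j ≠ xs

namespace NonterminatingRun

theorem block_le {k : ℕ} (h : NonterminatingRun f α β τ x₁ xs M c x B lam) (hB : (B k).PosDef)
    (h0 : f (x k 0) ≤ f x₁) (j : Fin (q + 1)) : f (x k j) ≤ f x₁ := by
  induction j using Fin.induction with
  | zero => exact h0
  | succ i ih =>
    have := h.bounds.step h.α_pos h.α_lt h.β_lt hB ih (h.bounds.gradient_ne_zero ih (h.ne _ _))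
      (h.run.line_search k i)
    rw [h.run.step k i]
    exact this.2.2.1.trans ih

theorem posDef_and_le (h : NonterminatingRun f α β τ x₁ xs M c x B lam) (k : ℕ) :
    (B k).PosDef ∧ ∀ j, f (x k j) ≤ f x₁ := by
  induction k with
  | zero => exact ⟨h.posDef_zero, h.block_le h.posDef_zero (by rw [h.run.start_point])⟩
  | succ k ih =>
    obtain ⟨hB, hle⟩ := ih
    have hB' : (B (k + 1)).PosDef := by
      rcases (keptSteps f τ (B k) (x k) (lam k)).eq_empty_or_nonempty with he | hne
      · rwa [h.run.no_update k he]
      · have hG := h.bounds.posSemidef _ (hle (Fin.last q))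
        have hGs : (hessian f (x k (Fin.last q)))ᵀ = hessian f (x k (Fin.last q)) := by
          simpa using hG.1.eq
        obtain ⟨hD, hDG⟩ := keptMatrix_spec (B := B k) (l := lam k) hG h.τ_pos h.bounds.M_pos.le
          (h.bounds.hessian_le _ (hle (Fin.last q))) fun i =>
            (h.bounds.step h.α_pos h.α_lt h.β_lt hB (hle _)
              (h.bounds.gradient_ne_zero (hle _) (h.ne _ _)) (h.run.line_search k i)).2.1
        have hK := one_le_filterConst (M := M) h.τ_pos h.bounds.M_pos.le q
        have hupd : B (k + 1) = blockUpdate (B k) (hessian f (x k (Fin.last q)))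
            (keptMatrix f τ (B k) (x k) (lam k)) := h.run.update k hne
        rw [hupd]
        exact posDef_blockUpdate hB (posDef_transpose_mul_mul hB hD) hGs
          (posDef_of_le_on_range Matrix.PosDef.one hGs hD (inv_pos.2 (zero_lt_one.trans_le hK))
            (by simpa using hDG))
    refine ⟨hB', h.block_le hB' ?_⟩
    rw [h.run.next_block]
    exact hle _

variable (h : NonterminatingRun f α β τ x₁ xs M c x B lam)
include h

theorem posDef (k : ℕ) : (B k).PosDef := (h.posDef_and_le k).1

theorem le (k : ℕ) (j : Fin (q + 1)) : f (x k j) ≤ f x₁ := (h.posDef_and_le k).2 j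

theorem step_spec (k : ℕ) (i : Fin q) :
    0 < lam k i ∧ blockSteps f (B k) (x k) (lam k) i ≠ 0 ∧
      f (x k i.succ) ≤ f (x k i.castSucc) ∧
      f (x k i.succ) - f xs ≤ f (x k i.castSucc) - f xs - α * (1 - β) / M * c *
        cosSq (B k) (blockSteps f (B k) (x k) (lam k) i).ofLp * (f (x k i.castSucc) - f xs) := by
  rw [h.run.step k i]
  exact h.bounds.step h.α_pos h.α_lt h.β_lt (h.posDef k) (h.le k _)
    (h.bounds.gradient_ne_zero (h.le k _) (h.ne _ _)) (h.run.line_search k i)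

theorem antitone_block (k : ℕ) : Antitone fun j => f (x k j) :=
  Fin.antitone_iff_succ_le.2 fun i => (h.step_spec k i).2.2.1

theorem antitone_value : Antitone fun k => f (x k 0) := by
  refine antitone_nat_of_succ_le fun k => ?_
  rw [h.run.next_block]
  exact h.antitone_block k (Fin.zero_le _)

theorem decrease_pos : 0 < α * (1 - β) / M * c := by
  have h1 := h.α_pos
  have h2 := sub_pos.2 h.β_lt
  have h3 := h.bounds.M_pos
  have h4 := h.bounds.c_pos
  positivity

theorem kept_spec (k : ℕ) :
    Function.Injective (keptMatrix f τ (B k) (x k) (lam k)).mulVec ∧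
      ∀ v, (filterConst τ M q)⁻¹ * ((keptMatrix f τ (B k) (x k) (lam k) *ᵥ v) ⬝ᵥ
          (keptMatrix f τ (B k) (x k) (lam k) *ᵥ v)) ≤
        (keptMatrix f τ (B k) (x k) (lam k) *ᵥ v) ⬝ᵥ hessian f (x k (Fin.last q)) *ᵥ
          (keptMatrix f τ (B k) (x k) (lam k) *ᵥ v) :=
  keptMatrix_spec (h.bounds.posSemidef _ (h.le k _)) h.τ_pos h.bounds.M_pos.le
    (h.bounds.hessian_le _ (h.le k _)) fun i => (h.step_spec k i).2.1

theorem transpose_hessian (k : ℕ) :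
    (hessian f (x k (Fin.last q)))ᵀ = hessian f (x k (Fin.last q)) := by
  simpa using (h.bounds.posSemidef _ (h.le k (Fin.last q))).1.eq

/-- A retained step that is nearly orthogonal to the gradient makes the potential drop. -/
theorem exp_potential_sub_le : ∃ C : ℝ, ∀ k, ∀ i ∈ keptSteps f τ (B k) (x k) (lam k),
    Real.exp (2 * (potential 1 (B (k + 1)) - potential 1 (B k) - C)) ≤
      2 * q * cosSq (B k) (blockSteps f (B k) (x k) (lam k) i).ofLp := by
  have hK := one_le_filterConst (M := M) h.τ_pos h.bounds.M_pos.le q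
  have hK0 := zero_lt_one.trans_le hK
  refine ⟨q * (M - Real.log (filterConst τ M q)⁻¹), fun k i hi => ?_⟩
  obtain ⟨hD, hDG⟩ := h.kept_spec k
  have hcard : (Fintype.card (keptSteps f τ (B k) (x k) (lam k)) : ℝ) ≤ q := by
    rw [Fintype.card_coe]
    exact_mod_cast (Finset.card_le_univ _).trans_eq (Fintype.card_fin q)
  have h1 := exp_potential_blockUpdate_le
    (y := Pi.single (⟨i, hi⟩ : keptSteps f τ (B k) (x k) (lam k)) 1)
    (c := M) (h.posDef k) (h.transpose_hessian k) hD (inv_pos.2 hK0) (by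
      have := dotProduct_inv_mulVec_le Matrix.PosDef.one
        (h.bounds.posSemidef _ (h.le k (Fin.last q))) h.bounds.M_pos
        (by simpa using h.bounds.hessian_le _ (h.le k (Fin.last q)))
      simpa using this) hDG (by simp)
  rw [keptMatrix_mulVec_single] at h1
  have h2 : blockUpdate (B k) (hessian f (x k (Fin.last q))) (keptMatrix f τ (B k) (x k) (lam k)) =
      B (k + 1) := (h.run.update k ⟨i, hi⟩).symm
  rw [h2] at h1
  have h3 : 0 ≤ M - Real.log (filterConst τ M q)⁻¹ := by
    rw [Real.log_inv]
    linarith [h.bounds.M_pos, Real.log_nonneg hK]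
  refine (Real.exp_le_exp.2 ?_).trans (h1.trans ?_)
  · have := mul_le_mul_of_nonneg_right hcard h3
    linarith
  · have := mul_le_mul_of_nonneg_right hcard
      (cosSq_nonneg (B k) (blockSteps f (B k) (x k) (lam k) i).ofLp)
    dsimp only
    linarith

/-- The values converge to the minimum. Otherwise the gradients stay away from `0`, so that the
angles tend to a right angle; then the potential stops growing, which keeps the angles away from a
right angle. -/
theorem tendsto_value (hq : 1 ≤ q) : Tendsto (fun k => f (x k 0)) atTop (𝓝 (f xs)) := by
  have hbdd : BddBelow (Set.range fun k => f (x k 0)) :=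
    ⟨f xs, by rintro _ ⟨k, rfl⟩; exact h.bounds.minimizer _⟩
  have hlim := tendsto_atTop_ciInf h.antitone_value hbdd
  set L := ⨅ k, f (x k 0) with hL
  have hLle : ∀ k, L ≤ f (x k 0) := fun k => ciInf_le hbdd k
  have hLs : f xs ≤ L := le_ciInf fun k => h.bounds.minimizer _
  rcases hLs.eq_or_lt with heq | hlt
  · rwa [← heq] at hlim
  exfalso
  -- if the values stay away from the minimum, all angles tend to a right angle
  set κ := α * (1 - β) / M * c with hκ
  have hκ0 : 0 < κ := h.decrease_pos
  have hcos : ∀ k i, κ * (L - f xs) * cosSq (B k) (blockSteps f (B k) (x k) (lam k) i).ofLp ≤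
      f (x k 0) - f (x (k + 1) 0) := by
    intro k i
    have h1 := (h.step_spec k i).2.2.2
    have h2 : f (x k i.castSucc) ≤ f (x k 0) := h.antitone_block k (Fin.zero_le _)
    have h3 : f (x (k + 1) 0) ≤ f (x k i.succ) := by
      rw [h.run.next_block]
      exact h.antitone_block k (Fin.le_last _)
    have h4 : L ≤ f (x k i.castSucc) := (hLle (k + 1)).trans (h3.trans (h.step_spec k i).2.2.1)
    have h5 := mul_le_mul_of_nonneg_left (sub_le_sub_right h4 (f xs))
      (mul_nonneg hκ0.le (cosSq_nonneg (B k) (blockSteps f (B k) (x k) (lam k) i).ofLp))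
    linarith
  have hdiff : Tendsto (fun k => f (x k 0) - f (x (k + 1) 0)) atTop (𝓝 0) := by
    have := hlim.sub ((tendsto_add_atTop_iff_nat 1).2 hlim)
    rwa [sub_self] at this
  have hsmall : ∀ ε > 0, ∀ᶠ k in atTop, ∀ i,
      cosSq (B k) (blockSteps f (B k) (x k) (lam k) i).ofLp < ε := by
    intro ε hε
    have hp : 0 < κ * (L - f xs) := mul_pos hκ0 (sub_pos.2 hlt)
    filter_upwards [hdiff.eventually_lt_const (mul_pos hp hε)] with k hk i
    exact lt_of_mul_lt_mul_left ((hcos k i).trans_lt hk) hp.le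
  -- hence the potential decreases eventually
  obtain ⟨C, hC⟩ := h.exp_potential_sub_le
  have hq0 : (0 : ℝ) < q := by exact_mod_cast hq
  obtain ⟨K, hKC⟩ := eventually_atTop.1 (hsmall (Real.exp (2 * (0 - C)) / (2 * q)) (by positivity))
  have hpot : ∀ k, K ≤ k → potential 1 (B k) ≤ potential 1 (B K) := by
    intro k hk
    induction k, hk using Nat.le_induction with
    | base => exact le_rfl
    | succ k hk ih =>
      refine le_trans ?_ ih
      rcases (keptSteps f τ (B k) (x k) (lam k)).eq_empty_or_nonempty with he | ⟨i, hi⟩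
      · rw [h.run.no_update k he]
      · have h1 := hKC k hk i
        rw [lt_div_iff₀ (by positivity), mul_comm] at h1
        have h2 := Real.exp_le_exp.1 ((hC k i hi).trans h1.le)
        linarith
  -- so that the angles are bounded away from a right angle
  obtain ⟨K', hK'⟩ := eventually_atTop.1
    (hsmall (Real.exp (-2 * (potential 1 (B K) + 1)) / 2) (by positivity))
  have h1 := hK' (max K K') (le_max_right _ _) ⟨0, hq⟩
  have h2 := exp_neg_potential_le_cosSq (h.posDef (max K K'))
    (h.step_spec (max K K') ⟨0, hq⟩).2.1
  have h3 := hpot (max K K') (le_max_left _ _)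
  have h4 : Real.exp (-2 * (potential 1 (B K) + 1)) ≤
      Real.exp (-2 * (potential 1 (B (max K K')) + 1)) := Real.exp_le_exp.2 (by linarith)
  linarith

theorem norm_sub_sq_le (k : ℕ) (j : Fin (q + 1)) :
    c * ‖x k j - xs‖ ^ 2 ≤ f (x k 0) - f xs :=
  (h.bounds.growth _ (h.le k j)).trans
    (sub_le_sub_right (h.antitone_block k (Fin.zero_le j)) _)

theorem tendsto_iterates (hq : 1 ≤ q) (j : Fin (q + 1)) :
    Tendsto (fun k => x k j) atTop (𝓝 xs) := by
  rw [tendsto_iff_norm_sub_tendsto_zero]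
  have h1 : Tendsto (fun k => Real.sqrt ((f (x k 0) - f xs) / c)) atTop (𝓝 0) := by
    have h2 := (((h.tendsto_value hq).sub_const (f xs)).div_const c).sqrt
    simpa using h2
  refine squeeze_zero (fun k => norm_nonneg _) (fun k => ?_) h1
  refine Real.le_sqrt_of_sq_le ?_
  rw [le_div_iff₀' h.bounds.c_pos]
  exact h.norm_sub_sq_le k j

/-- The errors decay geometrically, since `(f - f xs) exp (κ ψ)` does, where `ψ` is the potential
relative to the identity and `κ` is a small constant. -/
theorem summable_norm_sub
    (hne : ∀ᶠ k in atTop, (keptSteps f τ (B k) (x k) (lam k)).Nonempty) (hq : 1 ≤ q) :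
    Summable fun k => ‖x k (Fin.last q) - xs‖ := by
  obtain ⟨K, hK⟩ := eventually_atTop.1 hne
  obtain ⟨C, hC⟩ := h.exp_potential_sub_le
  have hq0 : (0 : ℝ) < q := by exact_mod_cast hq
  set κ := α * (1 - β) / M * c with hκ
  have hκ0 : 0 < κ := h.decrease_pos
  set ν := κ * (Real.exp (-2 * C) / (2 * q)) with hν
  have hν0 : 0 < ν := by positivity
  have hc := h.bounds.c_pos
  set ψ := fun k => potential 1 (B k) with hψ
  have hψ0 : ∀ k, 0 ≤ ψ k := by
    intro k
    have := le_potential Matrix.PosDef.one (h.posDef k)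
    rw [Matrix.det_one, Real.log_one, sub_zero] at this
    exact (Nat.cast_nonneg n).trans this
  set E := fun k => (f (x k 0) - f xs) * Real.exp (2 * ν * ψ k) with hE
  have hstep : ∀ k, K ≤ k → E (k + 1) ≤ Real.exp (-ν) * E k := by
    intro k hk
    obtain ⟨i, hi⟩ := hK k hk
    have h1 := (h.step_spec k i).2.2.2
    set t := cosSq (B k) (blockSteps f (B k) (x k) (lam k) i).ofLp with ht
    have h2 : f (x k i.castSucc) ≤ f (x k 0) := h.antitone_block k (Fin.zero_le _)
    have h3 : f (x (k + 1) 0) ≤ f (x k i.succ) := by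
      rw [h.run.next_block]
      exact h.antitone_block k (Fin.le_last _)
    have h4 : 0 ≤ f (x k i.castSucc) - f xs := sub_nonneg.2 (h.bounds.minimizer _)
    have ht1 : ν * (1 + 2 * (ψ (k + 1) - ψ k)) ≤ κ * t := by
      have h5 := hC k i hi
      have h6 : Real.exp (-2 * C) * (1 + 2 * (ψ (k + 1) - ψ k)) ≤ 2 * q * t := by
        refine le_trans ?_ h5
        have h7 : 2 * (potential 1 (B (k + 1)) - potential 1 (B k) - C) =
            -2 * C + 2 * (ψ (k + 1) - ψ k) := by simp only [hψ]; ring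
        rw [h7, Real.exp_add]
        gcongr
        linarith [Real.add_one_le_exp (2 * (ψ (k + 1) - ψ k))]
      rw [hν, mul_assoc]
      refine mul_le_mul_of_nonneg_left ?_ hκ0.le
      rw [div_mul_eq_mul_div, div_le_iff₀ (by positivity)]
      linarith
    have h8 : f (x (k + 1) 0) - f xs ≤
        Real.exp (-(ν * (1 + 2 * (ψ (k + 1) - ψ k)))) * (f (x k 0) - f xs) := by
      calc f (x (k + 1) 0) - f xs ≤ (1 - κ * t) * (f (x k i.castSucc) - f xs) := by linarith
        _ ≤ Real.exp (-(ν * (1 + 2 * (ψ (k + 1) - ψ k)))) * (f (x k i.castSucc) - f xs) := by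
            refine mul_le_mul_of_nonneg_right ?_ h4
            refine le_trans ?_ (Real.exp_le_exp.2 (neg_le_neg ht1))
            linarith [Real.add_one_le_exp (-(κ * t))]
        _ ≤ _ := by gcongr
    calc E (k + 1) ≤ Real.exp (-(ν * (1 + 2 * (ψ (k + 1) - ψ k)))) * (f (x k 0) - f xs) *
          Real.exp (2 * ν * ψ (k + 1)) := by
          simp only [hE]
          gcongr
      _ = (f (x k 0) - f xs) * (Real.exp (-(ν * (1 + 2 * (ψ (k + 1) - ψ k)))) *
          Real.exp (2 * ν * ψ (k + 1))) := by ring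
      _ = (f (x k 0) - f xs) * (Real.exp (-ν) * Real.exp (2 * ν * ψ k)) := by
          rw [← Real.exp_add, ← Real.exp_add]
          congr 2
          ring
      _ = _ := by simp only [hE]; ring
  have hE0 : ∀ k, 0 ≤ E k := fun k =>
    mul_nonneg (sub_nonneg.2 (h.bounds.minimizer _)) (Real.exp_pos _).le
  have hgeo : ∀ j, E (K + j) ≤ Real.exp (-ν) ^ j * E K := by
    intro j
    induction j with
    | zero => simp
    | succ j ih =>
      refine (hstep (K + j) (Nat.le_add_right _ _)).trans ?_
      rw [pow_succ', mul_assoc]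
      gcongr
  rw [← summable_nat_add_iff K]
  have hr : Real.exp (-ν / 2) < 1 := Real.exp_lt_one_iff.2 (by linarith)
  refine Summable.of_nonneg_of_le (fun j => norm_nonneg _) (fun j => ?_)
    ((summable_geometric_of_lt_one (Real.exp_pos (-ν / 2)).le hr).mul_left (Real.sqrt (E K / c)))
  have h1 := h.norm_sub_sq_le (j + K) (Fin.last q)
  have h2 : f (x (j + K) 0) - f xs ≤ E (j + K) := by
    refine le_mul_of_one_le_right (sub_nonneg.2 (h.bounds.minimizer _)) (Real.one_le_exp ?_)
    have := hψ0 (j + K)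
    positivity
  have h3 := hgeo j
  rw [add_comm K j] at h3
  refine abs_le_of_sq_le_sq' (b := Real.sqrt (E K / c) * Real.exp (-ν / 2) ^ j) ?_
    (by positivity) |>.2
  have hsq : (Real.exp (-ν / 2) ^ j) ^ 2 = Real.exp (-ν) ^ j := by
    rw [← pow_mul, mul_comm, pow_mul, ← Real.exp_nat_mul]
    congr 2
    push_cast
    ring
  rw [mul_pow, Real.sq_sqrt (div_nonneg (hE0 K) hc.le), hsq, div_mul_eq_mul_div, le_div_iff₀' hc]
  linarith

end NonterminatingRun

end Run

/-! ### Superlinear convergence -/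

section Superlinear

open scoped InnerProductSpace

variable {n q : ℕ} {f : Vec n → ℝ} {M c α β τ m μ : ℝ} {x₁ xs : Vec n}
  {x : ℕ → Fin (q + 1) → Vec n} {B : ℕ → Matrix (Fin n) (Fin n) ℝ} {lam : ℕ → Fin q → ℝ}

theorem abs_dotProduct_mulVec_le (A : Matrix (Fin n) (Fin n) ℝ) (v : Fin n → ℝ) :
    |v ⬝ᵥ A *ᵥ v| ≤ ‖A‖ * (v ⬝ᵥ v) := by
  have h1 := abs_real_inner_le_norm (WithLp.toLp 2 v)
    (Matrix.toEuclideanCLM (n := Fin n) (𝕜 := ℝ) A (WithLp.toLp 2 v))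
  rw [Matrix.inner_toEuclideanCLM] at h1
  have h2 := (Matrix.toEuclideanCLM (n := Fin n) (𝕜 := ℝ) A).le_opNorm (WithLp.toLp 2 v)
  rw [Matrix.l2_opNorm_toEuclideanCLM] at h2
  have h3 := norm_sq_eq_dotProduct (WithLp.toLp 2 v : Vec n)
  refine h1.trans ?_
  rw [← h3]
  nlinarith [norm_nonneg (WithLp.toLp 2 v : Vec n)]

theorem neg_log_one_sub_le {ε : ℝ} (h0 : 0 ≤ ε) (h1 : ε ≤ 1 / 2) : -Real.log (1 - ε) ≤ 2 * ε := by
  have hpos : 0 < 1 - ε := by linarith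
  have h2 := Real.one_sub_inv_le_log_of_pos hpos
  have h3 : (1 - ε)⁻¹ ≤ 1 + 2 * ε := by
    rw [inv_le_iff_one_le_mul₀ hpos]
    nlinarith
  linarith

namespace NonterminatingRun

variable (h : NonterminatingRun f α β τ x₁ xs M c x B lam)
include h

/-- If the Hessian at the end of a block is close to the Hessian at the minimizer, then the
potential relative to the latter barely increases, and it stays nearly constant only if `B` nearly
agrees with that Hessian on the retained steps. -/
theorem potential_hessian_step (hH : (hessian f xs).PosDef)
    (hmH : ∀ v : Fin n → ℝ, m * (v ⬝ᵥ v) ≤ v ⬝ᵥ hessian f xs *ᵥ v) {k : ℕ}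
    (hne : (keptSteps f τ (B k) (x k) (lam k)).Nonempty) {ε : ℝ} (hε0 : 0 ≤ ε) (hε : ε ≤ 1 / 2)
    (hclose : ‖hessian f (x k (Fin.last q)) - hessian f xs‖ ≤ ε * m) :
    0 ≤ potential (hessian f xs) (B k) - potential (hessian f xs) (B (k + 1)) + 3 * q * ε ∧
      (potential (hessian f xs) (B k) - potential (hessian f xs) (B (k + 1)) + 3 * q * ε ≤ 1 →
        ∀ i ∈ keptSteps f τ (B k) (x k) (lam k),
          ‖Matrix.toEuclideanCLM (n := Fin n) (𝕜 := ℝ) (B k - hessian f xs)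
              (blockSteps f (B k) (x k) (lam k) i)‖ ^ 2 ≤
            13 * q * M ^ 2 * (potential (hessian f xs) (B k) -
                potential (hessian f xs) (B (k + 1)) + 3 * q * ε) *
              ‖blockSteps f (B k) (x k) (lam k) i‖ ^ 2) := by
  set H := hessian f xs with hHdef
  set G := hessian f (x k (Fin.last q)) with hGdef
  set D := keptMatrix f τ (B k) (x k) (lam k) with hDdef
  have hxs : f xs ≤ f x₁ := h.bounds.minimizer _
  have hMH := h.bounds.hessian_le xs hxs
  have hpert : ∀ v : Fin n → ℝ, |v ⬝ᵥ G *ᵥ v - v ⬝ᵥ H *ᵥ v| ≤ ε * (v ⬝ᵥ H *ᵥ v) := by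
    intro v
    rw [← dotProduct_sub, ← Matrix.sub_mulVec]
    have hv : 0 ≤ v ⬝ᵥ v := Finset.sum_nonneg fun _ _ => mul_self_nonneg _
    calc _ ≤ ‖G - H‖ * (v ⬝ᵥ v) := abs_dotProduct_mulVec_le _ _
      _ ≤ ε * m * (v ⬝ᵥ v) := by gcongr
      _ = ε * (m * (v ⬝ᵥ v)) := by ring
      _ ≤ _ := by
          gcongr
          exact hmH v
  have hle : ∀ v : Fin n → ℝ, v ⬝ᵥ G *ᵥ v ≤ (1 + ε) * (v ⬝ᵥ H *ᵥ v) := fun v => by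
    linarith [(abs_le.1 (hpert v)).2]
  have hge : ∀ v : Fin n → ℝ, (1 - ε) * (v ⬝ᵥ H *ᵥ v) ≤ v ⬝ᵥ G *ᵥ v := fun v => by
    linarith [(abs_le.1 (hpert v)).1]
  have hc := dotProduct_inv_mulVec_le hH (h.bounds.posSemidef _ (h.le k (Fin.last q)))
    (by linarith) hle
  have hγ : 0 < 1 - ε := by linarith
  have hupd : B (k + 1) = blockUpdate (B k) G D := h.run.update k hne
  obtain ⟨hD, -⟩ := h.kept_spec k
  have hcard : (Fintype.card (keptSteps f τ (B k) (x k) (lam k)) : ℝ) ≤ q := by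
    rw [Fintype.card_coe]
    exact_mod_cast (Finset.card_le_univ _).trans_eq (Fintype.card_fin q)
  have hlog := neg_log_one_sub_le hε0 hε
  have hlog0 : 0 ≤ -Real.log (1 - ε) := neg_nonneg.2 (Real.log_nonpos hγ.le (by linarith))
  have hterm : Fintype.card (keptSteps f τ (B k) (x k) (lam k)) *
      (1 + ε - 1 - Real.log (1 - ε)) ≤ 3 * q * ε := by
    calc _ ≤ (q : ℝ) * (1 + ε - 1 - Real.log (1 - ε)) := by
          gcongr
          linarith
      _ ≤ q * (3 * ε) := by
          gcongr
          linarith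
      _ = _ := by ring
  have hpot := potential_blockUpdate_le (h.posDef k) hH (h.transpose_hessian k) hD hγ hc
    fun y => hge _
  rw [← hGdef, ← hDdef, ← hupd] at hpot
  refine ⟨by linarith, fun hδ i hi => ?_⟩
  set δ := potential H (B k) - potential H (B (k + 1)) + 3 * q * ε with hδdef
  have hδ0 : 0 ≤ δ := by rw [hδdef]; linarith
  have h1 := dotProduct_sub_mulVec_le (δ := δ) (h.posDef k) hH (h.transpose_hessian k) hD hγ hc
    (fun y => hge _) (by rw [← hGdef, ← hDdef, ← hupd]; linarith) hδ
    (Pi.single (⟨i, hi⟩ : keptSteps f τ (B k) (x k) (lam k)) 1)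
  rw [← hDdef, hDdef, keptMatrix_mulVec_single] at h1
  dsimp only at h1
  set s := blockSteps f (B k) (x k) (lam k) i with hs
  set w := (B k - H) *ᵥ s.ofLp with hw
  have hMpos := h.bounds.M_pos
  -- pass from the norms of `H` and `H⁻¹` to the Euclidean norm
  have h2 : w ⬝ᵥ w ≤ M * (w ⬝ᵥ H⁻¹ *ᵥ w) := by
    have h3 := dotProduct_inv_mulVec_le Matrix.PosDef.one hH.posSemidef hMpos
      (by simpa using hMH) (H⁻¹ *ᵥ w)
    rw [Matrix.mulVec_mulVec, Matrix.mul_nonsing_inv _ (isUnit_iff_ne_zero.2 hH.det_pos.ne'),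
      Matrix.one_mulVec, inv_one, Matrix.one_mulVec, dotProduct_comm (H⁻¹ *ᵥ w)] at h3
    exact h3
  rw [norm_sq_eq_dotProduct, Matrix.ofLp_toEuclideanCLM, norm_sq_eq_dotProduct, ← hw]
  have h4 := hMH s.ofLp
  have hss : 0 ≤ s.ofLp ⬝ᵥ s.ofLp := Finset.sum_nonneg fun _ _ => mul_self_nonneg _
  calc w ⬝ᵥ w ≤ M * (w ⬝ᵥ H⁻¹ *ᵥ w) := h2
    _ ≤ M * (13 * q * δ * (M * (s.ofLp ⬝ᵥ s.ofLp))) := by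
        refine mul_le_mul_of_nonneg_left (h1.trans ?_) hMpos.le
        have : 0 ≤ s.ofLp ⬝ᵥ H *ᵥ s.ofLp := by
          simpa using hH.posSemidef.dotProduct_mulVec_nonneg s.ofLp
        gcongr
    _ = _ := by ring

/-- Along the retained steps, `B` asymptotically agrees with the Hessian at the minimizer. -/
theorem eventually_norm_sub_hessian_le (hq : 1 ≤ q) (hH : (hessian f xs).PosDef) (hm : 0 < m)
    (hmH : ∀ v : Fin n → ℝ, m * (v ⬝ᵥ v) ≤ v ⬝ᵥ hessian f xs *ᵥ v)
    (hlip : ∃ U ∈ 𝓝 xs, ∀ x ∈ U, ∀ y ∈ U, ‖hessian f x - hessian f y‖ ≤ μ * ‖x - y‖)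
    (hne : ∀ᶠ k in atTop, (keptSteps f τ (B k) (x k) (lam k)).Nonempty) {η : ℝ} (hη : 0 < η) :
    ∀ᶠ k in atTop, ∀ i ∈ keptSteps f τ (B k) (x k) (lam k),
      ‖Matrix.toEuclideanCLM (n := Fin n) (𝕜 := ℝ) (B k - hessian f xs)
          (blockSteps f (B k) (x k) (lam k) i)‖ ≤ η * ‖blockSteps f (B k) (x k) (lam k) i‖ := by
  set ε := fun k => |μ| * ‖x k (Fin.last q) - xs‖ / m with hε
  have hsum : Summable ε := ((h.summable_norm_sub hne hq).mul_left |μ|).div_const m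
  have hε0 : ∀ k, 0 ≤ ε k := fun k => by positivity
  have hεlim := hsum.tendsto_atTop_zero
  obtain ⟨U, hU, hlip⟩ := hlip
  have hxU := (h.tendsto_iterates hq (Fin.last q)).eventually_mem hU
  have hclose : ∀ᶠ k in atTop, ‖hessian f (x k (Fin.last q)) - hessian f xs‖ ≤ ε k * m := by
    filter_upwards [hxU] with k hk
    refine (hlip _ hk _ (mem_of_mem_nhds hU)).trans ?_
    rw [hε, div_mul_cancel₀ _ hm.ne']
    gcongr
    exact le_abs_self μ
  set ψ := fun k => potential (hessian f xs) (B k) with hψ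
  set δ := fun k => ψ k - ψ (k + 1) + 3 * q * ε k with hδ
  obtain ⟨K, hK⟩ := eventually_atTop.1
    ((hclose.and (hεlim.eventually_le_const (show (0 : ℝ) < 1 / 2 by norm_num))).and hne)
  have hstep := fun k hk => h.potential_hessian_step hH hmH (hK k hk).2 (hε0 k) (hK k hk).1.2
    (hK k hk).1.1
  have hδlim : Tendsto δ atTop (𝓝 0) := by
    have hsumK : Summable fun j => ε (j + K) := (summable_nat_add_iff K).2 hsum
    have hδsum : Summable fun j => δ (j + K) := by
      refine summable_of_sum_range_le (c := ψ K - (n - Real.log (hessian f xs).det) +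
        3 * q * ∑' j, ε (j + K)) (fun j => (hstep (j + K) (Nat.le_add_left _ _)).1) fun N => ?_
      have h1 : ∑ j ∈ Finset.range N, δ (j + K) =
          ψ K - ψ (N + K) + 3 * q * ∑ j ∈ Finset.range N, ε (j + K) := by
        simp only [hδ, Finset.sum_add_distrib, ← Finset.mul_sum]
        congr 1
        have := Finset.sum_range_sub' (fun j => ψ (j + K)) N
        simp only [zero_add] at this
        rw [← this]
        refine Finset.sum_congr rfl fun j _ => ?_
        rw [add_right_comm]
      have h2 := hsumK.sum_le_tsum (Finset.range N) fun j _ => hε0 (j + K)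
      have h3 : n - Real.log (hessian f xs).det ≤ ψ (N + K) := le_potential hH (h.posDef _)
      have h4 : 3 * (q : ℝ) * ∑ j ∈ Finset.range N, ε (j + K) ≤ 3 * q * ∑' j, ε (j + K) := by
        gcongr
      rw [h1]
      linarith
    exact (tendsto_add_atTop_iff_nat K).1 hδsum.tendsto_atTop_zero
  have hMpos := h.bounds.M_pos
  have hq0 : (0 : ℝ) < q := by exact_mod_cast hq
  filter_upwards [eventually_ge_atTop K, hδlim.eventually_le_const one_pos,
    hδlim.eventually_le_const (show 0 < η ^ 2 / (13 * q * M ^ 2) by positivity)]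
    with k hk h1 h2 i hi
  have h3 := (hstep k hk).2 h1 i hi
  rw [le_div_iff₀' (by positivity)] at h2
  refine abs_le_of_sq_le_sq' (h3.trans ?_) (by positivity) |>.2
  rw [mul_pow]
  gcongr

/-- Superlinear convergence along the retained steps. -/
theorem eventually_norm_succ_le (hq : 1 ≤ q) (hα2 : α < 1 / 2) (hβ0 : 0 < β)
    (hH : (hessian f xs).PosDef) (hm : 0 < m)
    (hmH : ∀ v : Fin n → ℝ, m * (v ⬝ᵥ v) ≤ v ⬝ᵥ hessian f xs *ᵥ v)
    (hlip : ∃ U ∈ 𝓝 xs, ∀ x ∈ U, ∀ y ∈ U, ‖hessian f x - hessian f y‖ ≤ μ * ‖x - y‖)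
    (hne : ∀ᶠ k in atTop, (keptSteps f τ (B k) (x k) (lam k)).Nonempty) {ε : ℝ} (hε : 0 < ε) :
    ∀ᶠ k in atTop, ∀ i ∈ keptSteps f τ (B k) (x k) (lam k),
      ‖x k i.succ - xs‖ ≤ ε * ‖x k i.castSucc - xs‖ := by
  have hG : ∀ v, m * ‖v‖ ^ 2 ≤ ⟪v, fderiv ℝ (gradient f) xs v⟫_ℝ := by
    intro v
    rw [← dotProduct_hessian_mulVec, norm_sq_eq_dotProduct]
    exact hmH v.ofLp
  obtain ⟨η, hη, ρ, hρ, hunit⟩ := exists_unit_step h.bounds.differentiable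
    h.bounds.differentiable_gradient h.bounds.minimizer hm hG h.α_pos hα2 hβ0 h.β_lt hε
  have hnear : ∀ᶠ k in atTop, ∀ j, ‖x k j - xs‖ < ρ := by
    rw [eventually_all]
    intro j
    have := (tendsto_iff_norm_sub_tendsto_zero.1 (h.tendsto_iterates hq j))
    exact this.eventually_lt_const hρ
  filter_upwards [hnear, h.eventually_norm_sub_hessian_le hq hH hm hmH hlip hne hη]
    with k hk hB i hi
  obtain ⟨hlam, -, -, -⟩ := h.step_spec k i
  have h1 := hB i hi
  set d := direction f (B k) (x k i.castSucc) with hd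
  have hs : blockSteps f (B k) (x k) (lam k) i = lam k i • d := rfl
  have hnewton : gradient f (x k i.castSucc) + fderiv ℝ (gradient f) xs d =
      -Matrix.toEuclideanCLM (n := Fin n) (𝕜 := ℝ) (B k - hessian f xs) d := by
    have h2 : Matrix.toEuclideanCLM (n := Fin n) (𝕜 := ℝ) (B k) d =
        -gradient f (x k i.castSucc) := by
      apply WithLp.ofLp_injective 2
      rw [Matrix.ofLp_toEuclideanCLM, hd, mulVec_direction (h.posDef k), WithLp.ofLp_neg]
    rw [map_sub, _root_.sub_apply, h2, toEuclideanCLM_hessian]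
    abel
  rw [hs, map_smul, norm_smul, norm_smul, Real.norm_of_nonneg hlam.le] at h1
  have h3 : ‖Matrix.toEuclideanCLM (n := Fin n) (𝕜 := ℝ) (B k - hessian f xs) d‖ ≤ η * ‖d‖ := by
    refine le_of_mul_le_mul_left ?_ hlam
    linarith
  obtain ⟨h4, h5⟩ := hunit _ d (hk i.castSucc) (by rw [hnewton, norm_neg]; exact h3)
  have h6 := (h.run.line_search k i).2 h5
  rw [h.run.step k i, hs, h6, one_smul]
  exact h4

end NonterminatingRun

end Superlinear

/-- The bounds on the level set that follow from the assumptions on `f`. -/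
theorem exists_levelSetBounds {n : ℕ} {f : Vec n → ℝ} {x₁ xs : Vec n} {M m : ℝ}
    (hconv : ConvexOn ℝ Set.univ f)
    (hdiff : Differentiable ℝ f) (hdiff2 : Differentiable ℝ (gradient f))
    (hM : ∀ x, f x ≤ f x₁ → (M • (1 : Matrix (Fin n) (Fin n) ℝ) - hessian f x).PosSemidef)
    (hmin : ∀ x, f xs ≤ f x) (hm : 0 < m)
    (hS : ∀ᶠ x in 𝓝 xs, ∀ v : Fin n → ℝ, m * (v ⬝ᵥ v) ≤ v ⬝ᵥ hessian f x *ᵥ v) :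
    ∃ M' c, LevelSetBounds f (f x₁) xs M' c := by
  obtain ⟨r, hr, hball⟩ := Metric.nhds_basis_closedBall.eventually_iff.1 hS
  obtain ⟨c, hc, hbounds⟩ := exists_level_set_bounds hconv hdiff hdiff2 hmin hr hm
    (fun x hx v => by
      rw [← dotProduct_hessian_mulVec, norm_sq_eq_dotProduct]
      exact hball hx v.ofLp) (f x₁)
  refine ⟨max M 1, c, ⟨hconv, hdiff, hdiff2, hmin, by positivity, hc, fun x hx => ?_,
    fun x hx v => ?_, fun x hx => (hbounds x hx).1, fun x hx => (hbounds x hx).2.1,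
    fun x hx => (hbounds x hx).2.2⟩⟩
  · refine Matrix.PosSemidef.of_dotProduct_mulVec_nonneg ?_ fun v => ?_
    · -- the Hessian is symmetric because `M I - G` is
      have h1 : (M • (1 : Matrix (Fin n) (Fin n) ℝ)).IsHermitian := by
        simp [Matrix.IsHermitian]
      have h2 := h1.sub (hM x hx).isHermitian
      rwa [sub_sub_cancel] at h2
    · rw [star_trivial]
      have := inner_fderiv_gradient_nonneg hconv hdiff hdiff2 x (WithLp.toLp 2 v)
      rwa [← dotProduct_hessian_mulVec] at this
  · have h1 := (hM x hx).dotProduct_mulVec_nonneg v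
    rw [star_trivial, dotProduct_smul_sub_mulVec] at h1
    have hv : 0 ≤ v ⬝ᵥ v := Finset.sum_nonneg fun _ _ => mul_self_nonneg _
    have := mul_le_mul_of_nonneg_right (le_max_left M 1) hv
    linarith

/-- Once the iterates are close to the minimizer, the first step of every block is retained. -/
theorem eventually_keptSteps_nonempty {n q : ℕ} {f : Vec n → ℝ} {xs : Vec n} {m τ : ℝ}
    {x : ℕ → Fin (q + 1) → Vec n} {B : ℕ → Matrix (Fin n) (Fin n) ℝ} {lam : ℕ → Fin q → ℝ}
    (hq : 1 ≤ q) (hτm : τ ≤ m)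
    (hS : ∀ᶠ x in 𝓝 xs, ∀ v : Fin n → ℝ, m * (v ⬝ᵥ v) ≤ v ⬝ᵥ hessian f x *ᵥ v)
    (hx : Tendsto (fun k => x k (Fin.last q)) atTop (𝓝 xs)) :
    ∀ᶠ k in atTop, (keptSteps f τ (B k) (x k) (lam k)).Nonempty := by
  filter_upwards [hx.eventually hS] with k hk
  refine filterSteps_nonempty hq (fun v => le_trans ?_ (hk v)) _
  have hv : 0 ≤ v ⬝ᵥ v := Finset.sum_nonneg fun _ _ => mul_self_nonneg _
  gcongr

theorem tendsto_div_of_eventually_le {q : ℕ} {a b : ℕ → Fin q → ℝ} {s : ℕ → Finset (Fin q)}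
    (ha : ∀ k i, 0 ≤ a k i) (hb : ∀ k i, 0 ≤ b k i)
    (h : ∀ ε > 0, ∀ᶠ k in atTop, ∀ i ∈ s k, a k i ≤ ε * b k i) :
    Tendsto (fun p : ℕ × Fin q => a p.1 p.2 / b p.1 p.2)
      (comap Prod.fst atTop ⊓ 𝓟 {p : ℕ × Fin q | p.2 ∈ s p.1}) (𝓝 0) := by
  rw [Metric.tendsto_nhds]
  intro ε hε
  rw [eventually_inf_principal, eventually_comap]
  filter_upwards [h (ε / 2) (half_pos hε)] with k hk p hp hmem
  subst hp
  rw [dist_zero_right, Real.norm_of_nonneg (div_nonneg (ha _ _) (hb _ _))]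
  exact (div_le_of_le_mul₀ (hb _ _) (half_pos hε).le (hk p.2 hmem)).trans_lt (half_lt_self hε)

end BlockBFGS

theorem mainTheorem1 {n q : ℕ} (hq : 1 ≤ q)
    (f : BlockBFGS.Vec n → ℝ) (x₁ xstar : BlockBFGS.Vec n) (M μ m α β τ : ℝ)
    -- the function
    (hconv : ConvexOn ℝ Set.univ f)
    (hdiff : Differentiable ℝ f) (hdiff2 : Differentiable ℝ (gradient f))
    (hM : ∀ x, f x ≤ f x₁ →
      (M • (1 : Matrix (Fin n) (Fin n) ℝ) - BlockBFGS.hessian f x).PosSemidef)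
    (hmin : ∀ x, f xstar ≤ f x)
    (hns : IsUnit (BlockBFGS.hessian f xstar))
    (hlip : ∃ U ∈ 𝓝 xstar, ∀ x ∈ U, ∀ y ∈ U,
      ‖BlockBFGS.hessian f x - BlockBFGS.hessian f y‖ ≤ μ * ‖x - y‖)
    -- `m` is a strong convexity constant of `f` near the minimizer, and `τ ≤ m`
    (hm : 0 < m)
    (hS : ∃ S ∈ 𝓝 xstar, ∀ x ∈ S,
      (BlockBFGS.hessian f x - m • (1 : Matrix (Fin n) (Fin n) ℝ)).PosSemidef)
    (hτ : 0 < τ) (hτm : τ ≤ m)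
    -- the parameters of the line search
    (hα : 0 < α) (hα2 : α < 1 / 2) (hαβ : α < β) (hβ : β < 1)
    -- the run
    (B₁ : Matrix (Fin n) (Fin n) ℝ) (hB₁ : B₁.PosDef)
    (x : ℕ → Fin (q + 1) → BlockBFGS.Vec n)
    (B : ℕ → Matrix (Fin n) (Fin n) ℝ) (lam : ℕ → Fin q → ℝ)
    (hrun : BlockBFGS.IsRun f α β τ x₁ B₁ x B lam) :
    -- the iterates converge to the minimizer, and stay there if they ever reach it
    (∀ i, Tendsto (fun k => x k i) atTop (𝓝 xstar)) ∧
    (∀ k (i : Fin q), x k i.castSucc = xstar → x k i.succ = xstar) ∧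
    -- from some block on, at least one step is kept
    (∀ᶠ k in atTop, (BlockBFGS.keptSteps f τ (B k) (x k) (lam k)).Nonempty) ∧
    -- the error quotients of the kept steps tend to `0` as `k → ∞`
    Tendsto
      (fun p : ℕ × Fin q => ‖x p.1 p.2.succ - xstar‖ / ‖x p.1 p.2.castSucc - xstar‖)
      (comap Prod.fst atTop ⊓
        𝓟 {p : ℕ × Fin q | p.2 ∈ BlockBFGS.keptSteps f τ (B p.1) (x p.1) (lam p.1)})
      (𝓝 0) := by
  have hg0 : gradient f xstar = 0 := BlockBFGS.gradient_eq_zero_of_forall_le hmin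
  have hS' : ∀ᶠ y in 𝓝 xstar, ∀ v : Fin n → ℝ,
      m * (v ⬝ᵥ v) ≤ v ⬝ᵥ BlockBFGS.hessian f y *ᵥ v := by
    obtain ⟨S, hSn, hS⟩ := hS
    filter_upwards [hSn] with y hy v
    have h := (hS y hy).dotProduct_mulVec_nonneg v
    rw [star_trivial, ← neg_sub, Matrix.neg_mulVec, dotProduct_neg,
      BlockBFGS.dotProduct_smul_sub_mulVec] at h
    linarith
  have hstay : ∀ k (i : Fin q), x k i.castSucc = xstar → x k i.succ = xstar := by
    intro k i hi
    rw [hrun.succ_eq_of_gradient_eq_zero (by rw [hi, hg0]), hi]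
  by_cases hreach : ∃ k j, x k j = xstar
  · -- the run reaches the minimizer and stays there
    obtain ⟨k, j, hkj⟩ := hreach
    have hev : ∀ᶠ k' in atTop, ∀ j', x k' j' = xstar := by
      filter_upwards [eventually_gt_atTop k] with k' hk' j'
      exact hrun.eq_of_eq hg0 hkj hk' j'
    have hlim : ∀ i, Tendsto (fun k => x k i) atTop (𝓝 xstar) := fun i =>
      tendsto_const_nhds.congr' (hev.mono fun k hk => (hk i).symm)
    refine ⟨hlim, hstay, BlockBFGS.eventually_keptSteps_nonempty hq hτm hS' (hlim _), ?_⟩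
    refine BlockBFGS.tendsto_div_of_eventually_le
      (a := fun k i => ‖x k i.succ - xstar‖) (b := fun k i => ‖x k i.castSucc - xstar‖)
      (s := fun k => BlockBFGS.keptSteps f τ (B k) (x k) (lam k)) (fun _ _ => norm_nonneg _)
      (fun _ _ => norm_nonneg _) fun ε _ => ?_
    filter_upwards [hev] with k hk i _
    rw [hk, hk, sub_self, norm_zero, mul_zero]
  · push Not at hreach
    obtain ⟨M', c, hb⟩ := BlockBFGS.exists_levelSetBounds hconv hdiff hdiff2 hM hmin hm hS'
    have hrun' := hrun
    rw [← hrun.start_matrix] at hrun' hB₁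
    have h : BlockBFGS.NonterminatingRun f α β τ x₁ xstar M' c x B lam :=
      ⟨hb, hrun', hB₁, hα, by linarith, hβ, hτ, hreach⟩
    have hne := BlockBFGS.eventually_keptSteps_nonempty (B := B) (lam := lam) hq hτm hS'
      (h.tendsto_iterates hq (Fin.last q))
    have hH : (BlockBFGS.hessian f xstar).PosDef :=
      ((hb.posSemidef _ (hmin _)).posDef_iff_isUnit).2 hns
    exact ⟨h.tendsto_iterates hq, hstay, hne,
      BlockBFGS.tendsto_div_of_eventually_le
      (a := fun k i => ‖x k i.succ - xstar‖) (b := fun k i => ‖x k i.castSucc - xstar‖)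
      (s := fun k => BlockBFGS.keptSteps f τ (B k) (x k) (lam k)) (fun _ _ => norm_nonneg _)
        (fun _ _ => norm_nonneg _) fun ε hε => h.eventually_norm_succ_le hq hα2 (hα.trans hαβ) hH
          hm hS'.self_of_nhds hlip hne hε⟩
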